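/- Let \(\alpha<1\) be a real number and let \(1\le p\le\infty\). There is a constant \(C>0\), depending only on \(\alpha\) and \(p\), such that the following holds for every \(f\in L^p(0,1)\). There exists a unique function \(u_N\in W^{2,p}_{loc}((0,1])\) (that is, \(u_N\in W^{2,p}(\varepsilon,1)\) for every \(0<\varepsilon<1\); we use its \(C^1\) representative on \((0,1]\)) such that \[ -(x^{2\alpha}u_N'(x))'+u_N(x)=f(x)\ \text{ for a.e. }x\in(0,1),\qquad u_N(1)=0,\qquad \lim_{x\to0^+}x^{2\alpha}u_N'(x)=0 . \] Moreover, (i) \(u_N\in L^p(0,1)\) and \(\|u_N\|_{L^p}\le C\|f\|_{L^p}\); (ii) if \(p<\infty\), then \(\lim_{x\to0^+}x^{2\alpha-1+\frac1p}u_N'(x)=0\); if \(p=\infty\), then \(|x^{2\alpha-1}u_N'(x)|\le C\|f\|_{L^\infty}\) for all \(0<x<1\); (iii) \(x^{2\alpha}u_N'\in W^{1,p}(0,1)\) and \(\|x^{2\alpha}u_N'\|_{W^{1,p}}\le C\|f\|_{L^p}\); (iv) if \(p>1\), then \(x^{2\alpha-1}u_N'\) and \(x^{2\alpha}u_N''\)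 belong to \(L^p(0,1)\), and \(\|x^{2\alpha-1}u_N'\|_{L^p}+\|x^{2\alpha}u_N''\|_{L^p}\le C\|f\|_{L^p}\); (v) if \(0<\alpha<\frac12\), then (the continuous extension to \([0,1]\) of) \(u_N\) belongs to \(C^{0,\frac12-\alpha}[0,1]\), and \(\|u_N\|_{C^{0,\frac12-\alpha}}\le C\|f\|_{L^p}\); (vi) if \(\alpha\le0\), then \(u_N\in W^{1,p}(0,1)\) and \(\|u_N\|_{W^{1,p}}\le C\|f\|_{L^p}\). All derivatives that are not pointwise values of \(u_N'\) are weak derivatives, \(\|g\|_{W^{1,p}}=\|g\|_{L^p}+\|g'\|_{L^p}\), and \(\|g\|_{C^{0,\gamma}}=\sup_{[0,1]}|g|+\sup_{x\ne y}|g(x)-g(y)|/|x-y|^{\gamma}\). -/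

import Mathlib

open MeasureTheory Set Filter Topology
open scoped NNReal ENNReal ContDiff

/-- Lebesgue measure on the open interval `(a, b)`. -/
noncomputable abbrev volIoo (a b : ℝ) : Measure ℝ := volume.restrict (Ioo a b)

/-- `v` is a weak derivative of `u` on the open interval `(a, b)`: both functions are locally
integrable there and `∫ u φ' = - ∫ v φ` for every test function `φ ∈ C_c^∞(a, b)`. -/
structure IsWeakDeriv (a b : ℝ) (u v : ℝ → ℝ) : Prop where
  locallyIntegrable : LocallyIntegrableOn u (Ioo a b)
  locallyIntegrable_deriv : LocallyIntegrableOn v (Ioo a b)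
  integral_eq : ∀ φ : ℝ → ℝ, ContDiff ℝ ∞ φ → HasCompactSupport φ → tsupport φ ⊆ Ioo a b →
    ∫ x in Ioo a b, u x * deriv φ x = - ∫ x in Ioo a b, v x * φ x

/-- `u` has a weak derivative in `L¹_loc(a, b)`. -/
def WeaklyDifferentiable (a b : ℝ) (u : ℝ → ℝ) : Prop :=
  ∃ v : ℝ → ℝ, IsWeakDeriv a b u v

open Classical in
/-- The weak derivative of `u` on `(a, b)` (a representative; it is unique up to null sets),
and `0` if `u` is not weakly differentiable. -/
noncomputable def weakDeriv (a b : ℝ) (u : ℝ → ℝ) : ℝ → ℝ :=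
  if h : WeaklyDifferentiable a b u then h.choose else 0

theorem WeaklyDifferentiable.isWeakDeriv {a b : ℝ} {u : ℝ → ℝ}
    (h : WeaklyDifferentiable a b u) : IsWeakDeriv a b u (weakDeriv a b u) := by
  unfold weakDeriv
  rw [dif_pos h]
  exact h.choose_spec

/-- The Sobolev space `W^{1,p}(a, b)`. -/
def MemW1p (a b : ℝ) (p : ℝ≥0∞) (u : ℝ → ℝ) : Prop :=
  WeaklyDifferentiable a b u ∧ MemLp u p (volIoo a b) ∧ MemLp (weakDeriv a b u) p (volIoo a b)

/-- The norm `‖u‖_{L^p} + ‖u'‖_{L^p}` of `W^{1,p}(a, b)`; it is only used together with `MemW1p`. -/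
noncomputable def w1pNorm (a b : ℝ) (p : ℝ≥0∞) (u : ℝ → ℝ) : ℝ≥0∞ :=
  eLpNorm u p (volIoo a b) + eLpNorm (weakDeriv a b u) p (volIoo a b)

/-- The Sobolev space `W^{2,p}(a, b)`: `u` and its weak derivatives of order one and two
belong to `L^p(a, b)`. -/
def MemW2p (a b : ℝ) (p : ℝ≥0∞) (u : ℝ → ℝ) : Prop :=
  WeaklyDifferentiable a b u ∧ MemLp u p (volIoo a b) ∧ MemW1p a b p (weakDeriv a b u)

/-- The space `W^{2,p}_loc((0, 1])`: `u ∈ W^{2,p}(ε, 1)` for every `0 < ε < 1`. -/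
def MemW2pLoc (p : ℝ≥0∞) (u : ℝ → ℝ) : Prop :=
  ∀ ε : ℝ, 0 < ε → ε < 1 → MemW2p ε 1 p u

/-- `u ∈ W^{2,p}_loc((0, 1])` solves `-(x^{2α} u')' + u = f` a.e. on `(0, 1)`, with `u(1) = 0` and
`x^{2α} u'(x) → 0` as `x → 0⁺`. As `W^{2,p}_loc((0, 1]) ⊆ C¹((0, 1])`, every element of the
space has exactly one `C¹` representative on `(0, 1]`; `u` is that representative, so `u(1)`
and the pointwise values `u'(x)`, `0 < x < 1`, make sense classically. -/
structure IsNeumannSolution (α : ℝ) (p : ℝ≥0∞) (f u : ℝ → ℝ) : Prop where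
  memW2pLoc : MemW2pLoc p u
  contDiffOn : ContDiffOn ℝ 1 u (Ioc 0 1)
  weaklyDifferentiable : WeaklyDifferentiable 0 1 (fun x => x ^ (2 * α) * deriv u x)
  equation : ∀ᵐ x ∂(volIoo 0 1),
    - weakDeriv 0 1 (fun y => y ^ (2 * α) * deriv u y) x + u x = f x
  dirichlet_one : u 1 = 0
  neumann_zero : Tendsto (fun x => x ^ (2 * α) * deriv u x) (𝓝[>] 0) (𝓝 0)

/-- The norm of the Hölder space `C^{0,γ}[0, 1]`: the supremum of `|u|` plus the best Hölder
constant of `u` on `[0, 1]`. It is `∞` exactly when `u` is not in the space. -/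
noncomputable def holderNorm01 (γ : ℝ≥0) (u : ℝ → ℝ) : ℝ≥0∞ :=
  (⨆ x ∈ Icc (0 : ℝ) 1, ‖u x‖ₑ) + eHolderNorm γ ((Icc (0 : ℝ) 1).domRestrict u)

/-! Put β = 2 - 2α > 0. With the flux w = x^{2α} u' the equation becomes the first-order system u' =
x^{-2α} w, w' = u - f.

Existence is by reduction of order. The homogeneous equation has a solution φ that is a power series
in x^β with nonnegative coefficients and constant term 1, so 1 ≤ φ ≤ φ(1) on (0, 1], and its flux ψ
is the primitive of φ vanishing at 0. Substituting u = φ v leaves x^{2α} φ² v' = -F with F(x) =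
∫_0^x f φ, and v(x) = ∫_x^1 t^{-2α} φ^{-2} F dt meets both boundary conditions
(`exists_regular_solution`). Hölder gives |F(t)| ≤ φ(1) ‖f‖_p t^{1-1/p}, so u is dominated by ‖f‖_p
times the tail ∫_x^1 t^{β-1-1/p} dt, which lies in L^p(0, 1) because β > 0
(`exists_isFlux_of_memLp`).

Hence g = u - f is controlled in L^p by f, and w(x) = ∫_0^x g (`IsFlux.eq_integral`). All other
estimates follow from this formula. Hölder on (0, x) bounds w pointwise; Hardy's inequality
(`exists_hardy_const`) bounds w/x = x^{2α-1} u' in L^p when p > 1, and then x^{2α} u'' = g - 2α w/x;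
boundedness of w in u' = x^{-2α} w gives the Hölder and Sobolev regularity.

Uniqueness (`IsNeumannSolution.eqOn`) is an energy argument. For the difference d of two solutions,
with flux w, one has (d w)' = x^{-2α} w² + d² ≥ 0 and d(1) = 0, so d w ≤ 0. Then (w²)' = 2 d w ≤ 0,
and since w → 0 at 0 both w and d = w' vanish. The weak derivative of w has to be made classical
first, which is the role of the du Bois-Reymond lemma. -/

/-! ### Locally absolutely continuous functions and their weak derivatives -/

/-- `U` is locally absolutely continuous on `(a, b)` with almost everywhere derivative `g`. -/
structure IsLocPrimitive (a b : ℝ) (U g : ℝ → ℝ) : Prop where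
  locallyIntegrable : LocallyIntegrableOn g (Ioo a b)
  absolutelyContinuous : ∀ x ∈ Ioo a b, ∀ y ∈ Ioo a b, AbsolutelyContinuousOnInterval U x y
  hasDerivAt : ∀ᵐ x, x ∈ Ioo a b → HasDerivAt U (g x) x

theorem MeasureTheory.LocallyIntegrableOn.intervalIntegrable_of_mem_Ioo {a b x y : ℝ} {g : ℝ → ℝ}
    (hg : LocallyIntegrableOn g (Ioo a b)) (hx : x ∈ Ioo a b) (hy : y ∈ Ioo a b) :
    IntervalIntegrable g volume x y := by
  rw [intervalIntegrable_iff]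
  exact (hg.integrableOn_compact_subset (ordConnected_Ioo.uIcc_subset hx hy)
    isCompact_uIcc).mono_set uIoc_subset_uIcc

theorem locallyIntegrableOn_Ioo_of_continuousOn {a b : ℝ} {g : ℝ → ℝ}
    (hg : ContinuousOn g (Ioo a b)) : LocallyIntegrableOn g (Ioo a b) :=
  hg.locallyIntegrableOn measurableSet_Ioo

theorem locallyIntegrableOn_mul_continuousOn {a b : ℝ} {g h : ℝ → ℝ}
    (hg : LocallyIntegrableOn g (Ioo a b)) (hh : ContinuousOn h (Ioo a b)) :
    LocallyIntegrableOn (fun x => g x * h x) (Ioo a b) :=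
  hg.mul_continuousOn hh isOpen_Ioo.isLocallyClosed

theorem MeasureTheory.LocallyIntegrableOn.congr_ae_restrict {s : Set ℝ} {g h : ℝ → ℝ}
    (hg : LocallyIntegrableOn g s) (hgh : g =ᵐ[volume.restrict s] h) : LocallyIntegrableOn h s := by
  intro x hx
  obtain ⟨t, ht, hgt⟩ := hg x hx
  refine ⟨t ∩ s, inter_mem ht self_mem_nhdsWithin, ?_⟩
  exact (hgt.mono_set inter_subset_left).congr
    (ae_restrict_of_ae_restrict_of_subset inter_subset_right hgh)

/-- Only a compact subset of the interval matters, and there local integrability is integrability.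
The set K is kept separate from the support of φ so that one K serves a test function and its
derivative. -/
theorem integrableOn_mul_test {a b : ℝ} {u : ℝ → ℝ} (hu : LocallyIntegrableOn u (Ioo a b)) {φ : ℝ → ℝ} (hφ : ContinuousOn φ (Ioo a b))
    {K : Set ℝ} (hK : IsCompact K) (hKab : K ⊆ Ioo a b) (h0 : ∀ x ∉ K, φ x = 0) :
    IntegrableOn (fun x => u x * φ x) (Ioo a b) := by
  have h1 := (locallyIntegrableOn_mul_continuousOn hu hφ).integrableOn_compact_subset
    hKab hK
  have h2 : Function.support (fun x => u x * φ x) ⊆ K := fun x hx => by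
    by_contra h
    exact hx (by simp [h0 x h])
  exact ((integrableOn_iff_integrable_of_support_subset h2).1 h1).integrableOn

namespace IsLocPrimitive

variable {a b : ℝ} {U V g h : ℝ → ℝ}

theorem continuousOn (hU : IsLocPrimitive a b U g) : ContinuousOn U (Ioo a b) := by
  intro x hx
  obtain ⟨c, hc⟩ := exists_between hx.1
  obtain ⟨d, hd⟩ := exists_between hx.2
  have hcd : c ≤ d := (hc.2.trans hd.1).le
  have := (hU.absolutelyContinuous c ⟨hc.1, hc.2.trans hx.2⟩ d ⟨hx.1.trans hd.1, hd.2⟩).continuousOn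
  rw [uIcc_of_le hcd] at this
  exact (this.continuousAt (Icc_mem_nhds hc.2 hd.1)).continuousWithinAt

theorem mul (hU : IsLocPrimitive a b U g) (hV : IsLocPrimitive a b V h) :
    IsLocPrimitive a b (fun x => U x * V x) (fun x => g x * V x + U x * h x) where
  locallyIntegrable := by
    refine (locallyIntegrableOn_mul_continuousOn hU.locallyIntegrable hV.continuousOn).add ?_
    simp only [mul_comm (U _)]
    exact locallyIntegrableOn_mul_continuousOn hV.locallyIntegrable hU.continuousOn
  absolutelyContinuous x hx y hy :=
    (hU.absolutelyContinuous x hx y hy).mul (hV.absolutelyContinuous x hx y hy)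
  hasDerivAt := by
    filter_upwards [hU.hasDerivAt, hV.hasDerivAt] with x h1 h2 hx
    exact (h1 hx).mul (h2 hx)

theorem sub (hU : IsLocPrimitive a b U g) (hV : IsLocPrimitive a b V h) :
    IsLocPrimitive a b (fun x => U x - V x) (fun x => g x - h x) where
  locallyIntegrable := hU.locallyIntegrable.sub hV.locallyIntegrable
  absolutelyContinuous x hx y hy :=
    (hU.absolutelyContinuous x hx y hy).sub (hV.absolutelyContinuous x hx y hy)
  hasDerivAt := by
    filter_upwards [hU.hasDerivAt, hV.hasDerivAt] with x h1 h2 hx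
    exact (h1 hx).sub (h2 hx)

theorem mono {c d : ℝ} (hU : IsLocPrimitive a b U g) (h : Ioo c d ⊆ Ioo a b) :
    IsLocPrimitive c d U g where
  locallyIntegrable := hU.locallyIntegrable.mono_set h
  absolutelyContinuous x hx y hy := hU.absolutelyContinuous x (h hx) y (h hy)
  hasDerivAt := by
    filter_upwards [hU.hasDerivAt] with x h1 hx using h1 (h hx)

theorem congr_ae (hU : IsLocPrimitive a b U g) (h' : ∀ᵐ x, x ∈ Ioo a b → g x = h x) :
    IsLocPrimitive a b U h where
  locallyIntegrable := by
    have : g =ᵐ[volume.restrict (Ioo a b)] h := (ae_restrict_iff' measurableSet_Ioo).2 h'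
    exact hU.locallyIntegrable.congr_ae_restrict this
  absolutelyContinuous := hU.absolutelyContinuous
  hasDerivAt := by
    filter_upwards [hU.hasDerivAt, h'] with x h1 h2 hx using h2 hx ▸ h1 hx

theorem of_hasDerivAt (hd : ∀ x ∈ Ioo a b, HasDerivAt U (g x) x) (hg : ContinuousOn g (Ioo a b)) :
    IsLocPrimitive a b U g where
  locallyIntegrable := locallyIntegrableOn_Ioo_of_continuousOn hg
  absolutelyContinuous x hx y hy := by
    have : ContDiffOn ℝ 1 U (Ioo a b) := by
      rw [show (1 : WithTop ℕ∞) = 0 + 1 from rfl, contDiffOn_succ_iff_deriv_of_isOpen isOpen_Ioo]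
      refine ⟨fun x hx => (hd x hx).differentiableAt.differentiableWithinAt, by simp, ?_⟩
      rw [contDiffOn_zero]
      exact hg.congr fun x hx => (hd x hx).deriv
    exact (this.mono (ordConnected_Ioo.uIcc_subset hx hy)).absolutelyContinuousOnInterval
  hasDerivAt := .of_forall hd

theorem of_integral (hab : a ≤ b) (hg : IntegrableOn g (Ioo a b)) :
    IsLocPrimitive a b (fun x => ∫ t in a..x, g t) g := by
  have hI : IntervalIntegrable g volume a b :=
    (intervalIntegrable_iff_integrableOn_Ioo_of_le hab).2 hg
  refine ⟨hg.locallyIntegrableOn, fun x hx y hy => ?_, ?_⟩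
  · refine (hI.absolutelyContinuousOnInterval_intervalIntegral (c := a) left_mem_uIcc).mono ?_
    rw [uIcc_of_le hab]
    exact ordConnected_Icc.uIcc_subset (Ioo_subset_Icc_self hx) (Ioo_subset_Icc_self hy)
  · filter_upwards [hI.ae_hasDerivAt_integral] with x h1 hx
    rw [uIcc_of_le hab] at h1
    exact h1 (Ioo_subset_Icc_self hx) a (left_mem_Icc.2 hab)

theorem integral_eq_sub (hU : IsLocPrimitive a b U g) {x y : ℝ} (hx : x ∈ Ioo a b)
    (hy : y ∈ Ioo a b) : ∫ t in x..y, g t = U y - U x := by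
  rw [← (hU.absolutelyContinuous x hx y hy).integral_deriv_eq_sub]
  refine intervalIntegral.integral_congr_ae ?_
  filter_upwards [hU.hasDerivAt] with t ht h't
  exact (ht (ordConnected_Ioo.uIcc_subset hx hy (uIoc_subset_uIcc h't))).deriv.symm

/-- A function vanishing outside a compact subset of `(a, b)` that is locally absolutely
continuous has a derivative of zero mean. -/
theorem setIntegral_eq_zero (hab : a < b) (hU : IsLocPrimitive a b U g) {K : Set ℝ} (hK : IsCompact K)
    (hKab : K ⊆ Ioo a b) (hU0 : ∀ x ∉ K, U x = 0) (hg0 : ∀ x ∉ K, g x = 0) :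
    ∫ x in Ioo a b, g x = 0 := by
  -- The points c and d enclose K strictly, so U vanishes at both of them.
  obtain ⟨c, d, hcd, hc, hd, hKcd⟩ : ∃ c d, c ≤ d ∧ c ∈ Ioo a b ∧ d ∈ Ioo a b ∧ K ⊆ Ioo c d := by
    rcases K.eq_empty_or_nonempty with rfl | hne
    · obtain ⟨c, hc⟩ := exists_between hab
      exact ⟨c, c, le_rfl, hc, hc, empty_subset _⟩
    · obtain ⟨l, hl⟩ := hK.exists_isLeast hne
      obtain ⟨m, hm⟩ := hK.exists_isGreatest hne
      obtain ⟨c, hc⟩ := exists_between (hKab hl.1).1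
      obtain ⟨d, hd⟩ := exists_between (hKab hm.1).2
      have hlm : l ≤ m := hl.2 hm.1
      have := (hKab hl.1).2
      have := (hKab hm.1).1
      exact ⟨c, d, by linarith, ⟨hc.1, by linarith⟩, ⟨by linarith, hd.2⟩,
        fun x hx => ⟨hc.2.trans_le (hl.2 hx), (hm.2 hx).trans_lt hd.1⟩⟩
  have h1 : ∫ x in Ioo a b, g x = ∫ x in Ioo c d, g x := by
    refine setIntegral_eq_of_subset_of_forall_sdiff_eq_zero measurableSet_Ioo
      (Ioo_subset_Ioo hc.1.le hd.2.le) fun x hx => hg0 x fun hxK => hx.2 (hKcd hxK)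
  rw [h1, ← integral_Ioc_eq_integral_Ioo, ← intervalIntegral.integral_of_le hcd,
    hU.integral_eq_sub hc hd, hU0 _ fun h => (hKcd h).1.false, hU0 _ fun h => (hKcd h).2.false,
    sub_zero]

/-- Integration by parts: U φ is locally absolutely continuous and vanishes off the support of φ, so
its derivative g φ + U φ' has zero integral. -/
theorem isWeakDeriv (hU : IsLocPrimitive a b U g) : IsWeakDeriv a b U g where
  locallyIntegrable := locallyIntegrableOn_Ioo_of_continuousOn hU.continuousOn
  locallyIntegrable_deriv := hU.locallyIntegrable
  integral_eq φ hφ hφc hφs := by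
    rcases le_or_gt b a with hba | hab
    · simp [Ioo_eq_empty hba.not_gt]
    have hφd : IsLocPrimitive a b φ (deriv φ) :=
      .of_hasDerivAt (fun x _ => (hφ.differentiable (by simp) x).hasDerivAt)
        (hφ.continuous_deriv (by simp)).continuousOn
    have h0 : ∀ x ∉ tsupport φ, φ x = 0 := fun x hx => image_eq_zero_of_notMem_tsupport hx
    have h0' : ∀ x ∉ tsupport φ, deriv φ x = 0 := fun x hx =>
      image_eq_zero_of_notMem_tsupport fun h => hx (tsupport_deriv_subset h)
    have key := (hU.mul hφd).setIntegral_eq_zero hab hφc hφs (fun x hx => by simp [h0 x hx])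
      (fun x hx => by simp [h0 x hx, h0' x hx])
    rw [integral_add (integrableOn_mul_test hU.locallyIntegrable hφd.continuousOn hφc hφs h0)
      (integrableOn_mul_test (locallyIntegrableOn_Ioo_of_continuousOn hU.continuousOn)
        (hφ.continuous_deriv (by simp)).continuousOn hφc hφs h0')] at key
    linarith

end IsLocPrimitive

/-! ### Uniqueness of weak derivatives and the du Bois-Reymond lemma -/

namespace IsWeakDeriv

variable {a b : ℝ} {u v v' : ℝ → ℝ}

theorem ae_eq (h : IsWeakDeriv a b u v) (h' : IsWeakDeriv a b u v') :
    v =ᵐ[volIoo a b] v' := by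
  have := isOpen_Ioo.ae_eq_zero_of_integral_contDiff_smul_eq_zero (μ := volume)
    (h.locallyIntegrable_deriv.sub h'.locallyIntegrable_deriv) (fun φ hφ hφc hφs => ?_)
  · rw [Filter.EventuallyEq, ae_restrict_iff' measurableSet_Ioo]
    filter_upwards [this] with x hx hx'
    simpa [sub_eq_zero] using hx hx'
  · have h0 : ∀ x ∉ tsupport φ, φ x = 0 := fun x hx => image_eq_zero_of_notMem_tsupport hx
    have e1 := h.integral_eq φ hφ hφc hφs
    have e2 := h'.integral_eq φ hφ hφc hφs
    have e3 : ∫ x, φ x • (v - v') x = ∫ x in Ioo a b, (v x * φ x - v' x * φ x) := by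
      rw [← setIntegral_eq_integral_of_forall_compl_eq_zero (s := Ioo a b)]
      · congr 1 with x
        simp; ring
      · intro x hx
        simp [h0 x fun h => hx (hφs h)]
    rw [e3, integral_sub (integrableOn_mul_test h.locallyIntegrable_deriv hφ.continuous.continuousOn hφc hφs h0)
      (integrableOn_mul_test h'.locallyIntegrable_deriv hφ.continuous.continuousOn hφc hφs h0)]
    linarith

theorem weaklyDifferentiable (h : IsWeakDeriv a b u v) : WeaklyDifferentiable a b u := ⟨v, h⟩

theorem weakDeriv_ae_eq (h : IsWeakDeriv a b u v) : weakDeriv a b u =ᵐ[volIoo a b] v :=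
  h.weaklyDifferentiable.isWeakDeriv.ae_eq h

theorem memW1p {p : ℝ≥0∞} (h : IsWeakDeriv a b u v) (hu : MemLp u p (volIoo a b))
    (hv : MemLp v p (volIoo a b)) : MemW1p a b p u :=
  ⟨h.weaklyDifferentiable, hu, (memLp_congr_ae h.weakDeriv_ae_eq).2 hv⟩

theorem w1pNorm_eq {p : ℝ≥0∞} (h : IsWeakDeriv a b u v) :
    w1pNorm a b p u = eLpNorm u p (volIoo a b) + eLpNorm v p (volIoo a b) := by
  rw [w1pNorm, eLpNorm_congr_ae h.weakDeriv_ae_eq]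

theorem congr_ae_left {u' : ℝ → ℝ} (h : IsWeakDeriv a b u v) (hu : u =ᵐ[volIoo a b] u') :
    IsWeakDeriv a b u' v where
  locallyIntegrable := h.locallyIntegrable.congr_ae_restrict hu
  locallyIntegrable_deriv := h.locallyIntegrable_deriv
  integral_eq φ hφ hφc hφs := by
    rw [← h.integral_eq φ hφ hφc hφs]
    refine integral_congr_ae ?_
    filter_upwards [hu] with x hx
    rw [hx]

theorem sub {u' : ℝ → ℝ} (h : IsWeakDeriv a b u v) (h' : IsWeakDeriv a b u' v') :
    IsWeakDeriv a b (fun x => u x - u' x) (fun x => v x - v' x) where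
  locallyIntegrable := h.locallyIntegrable.sub h'.locallyIntegrable
  locallyIntegrable_deriv := h.locallyIntegrable_deriv.sub h'.locallyIntegrable_deriv
  integral_eq φ hφ hφc hφs := by
    have h0 : ∀ x ∉ tsupport φ, φ x = 0 := fun x hx => image_eq_zero_of_notMem_tsupport hx
    have h0' : ∀ x ∉ tsupport φ, deriv φ x = 0 := fun x hx =>
      image_eq_zero_of_notMem_tsupport fun h => hx (tsupport_deriv_subset h)
    have e1 := h.integral_eq φ hφ hφc hφs
    have e2 := h'.integral_eq φ hφ hφc hφs
    have hc := hφ.continuous_deriv (by simp)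
    simp only [sub_mul]
    rw [integral_sub (integrableOn_mul_test h.locallyIntegrable hc.continuousOn hφc hφs h0')
      (integrableOn_mul_test h'.locallyIntegrable hc.continuousOn hφc hφs h0'),
      integral_sub (integrableOn_mul_test h.locallyIntegrable_deriv hφ.continuous.continuousOn hφc hφs h0)
      (integrableOn_mul_test h'.locallyIntegrable_deriv hφ.continuous.continuousOn hφc hφs h0), e1, e2]
    ring

/-- The du Bois-Reymond lemma. -/
theorem exists_eq_const (hu : ContinuousOn u (Ioo a b)) (h : IsWeakDeriv a b u 0) :
    ∃ k, ∀ x ∈ Ioo a b, u x = k := by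
  rcases le_or_gt b a with hba | hab
  · exact ⟨0, by simp [Ioo_eq_empty hba.not_gt]⟩
  obtain ⟨m, hm⟩ := exists_between hab
  obtain ⟨r, hr, hrab⟩ := Metric.nhds_basis_closedBall.mem_iff.1 (Ioo_mem_nhds hm.1 hm.2)
  let B : ContDiffBump m := ⟨r / 2, r, by positivity, by linarith⟩
  set ρ : ℝ → ℝ := B.normed volume with hρ
  have hρd : ContDiff ℝ ∞ ρ := B.contDiff_normed
  have hρc : HasCompactSupport ρ := B.hasCompactSupport_normed
  have hρs : tsupport ρ ⊆ Ioo a b := by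
    rw [hρ, B.tsupport_normed_eq]; exact hrab
  have hρ1 : ∫ x, ρ x = 1 := B.integral_normed
  have z0 : ∀ {φ : ℝ → ℝ}, ∀ x ∉ tsupport φ, φ x = 0 := fun x hx =>
    image_eq_zero_of_notMem_tsupport hx
  refine ⟨∫ x in Ioo a b, u x * ρ x, ?_⟩
  set k := ∫ x in Ioo a b, u x * ρ x with hk
  have hconst : ContinuousOn (fun _ : ℝ => k) (Ioo a b) := continuousOn_const
  have main := isOpen_Ioo.ae_eq_zero_of_integral_contDiff_smul_eq_zero (μ := volume)
    (h.locallyIntegrable.sub (locallyIntegrableOn_Ioo_of_continuousOn hconst))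
    (fun ψ hψ hψc hψs => ?_)
  · have : u =ᵐ[volume.restrict (Ioo a b)] fun _ => k := by
      rw [Filter.EventuallyEq, ae_restrict_iff' measurableSet_Ioo]
      filter_upwards [main] with x hx hx'
      simpa [sub_eq_zero] using hx hx'
    exact Measure.eqOn_open_of_ae_eq this isOpen_Ioo hu hconst
  · set c := ∫ x, ψ x with hc
    -- Subtracting c ρ, where ρ has integral 1, gives θ zero mean; its primitive is then again a
    -- test function, and testing with it shows that u - k is orthogonal to ψ.
    set θ : ℝ → ℝ := fun x => ψ x - c * ρ x with hθ
    have hθd : ContDiff ℝ ∞ θ := hψ.sub (contDiff_const.mul hρd)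
    set K := tsupport ψ ∪ tsupport ρ with hK
    have hKc : IsCompact K := hψc.isCompact.union hρc
    have hKab : K ⊆ Ioo a b := union_subset hψs hρs
    have hθ0 : ∀ x ∉ K, θ x = 0 := fun x hx => by
      have h1 : x ∉ tsupport ψ := fun h => hx (.inl h)
      have h2 : x ∉ tsupport ρ := fun h => hx (.inr h)
      simp [hθ, z0 x h1, z0 x h2]
    have hθi : Integrable θ := (hψ.continuous.integrable_of_hasCompactSupport hψc).sub
      ((hρd.continuous.integrable_of_hasCompactSupport hρc).const_mul c)
    have hθint : ∫ x, θ x = 0 := by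
      rw [hθ, integral_sub (hψ.continuous.integrable_of_hasCompactSupport hψc)
        ((hρd.continuous.integrable_of_hasCompactSupport hρc).const_mul c), integral_const_mul, hρ1]
      simp [hc]
    set φ : ℝ → ℝ := fun x => ∫ t in Iic x, θ t with hφ
    have hφe : ∀ x, φ x = φ a + ∫ t in a..x, θ t := fun x => by
      rw [intervalIntegral.integral_Iic_sub_Iic hθi.integrableOn hθi.integrableOn |>.symm]
      simp [hφ]
    have hφd : ∀ x, HasDerivAt φ (θ x) x := fun x => by
      rw [funext hφe]
      exact (intervalIntegral.integral_hasDerivAt_right (hθi.intervalIntegrable)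
        (hθd.continuous.stronglyMeasurableAtFilter _ _) hθd.continuous.continuousAt).const_add _
    have hφ' : deriv φ = θ := funext fun x => (hφd x).deriv
    have hφs : ContDiff ℝ ∞ φ := by
      rw [contDiff_infty_iff_deriv, hφ']
      exact ⟨fun x => (hφd x).differentiableAt, hθd⟩
    obtain ⟨l, n, hKln, hln⟩ : ∃ l n, K ⊆ Icc l n ∧ Icc l n ⊆ Ioo a b := by
      rcases K.eq_empty_or_nonempty with h0 | hne
      · exact ⟨m, m, by simp [h0], by simpa using hm⟩
      · obtain ⟨l, hl⟩ := hKc.exists_isLeast hne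
        obtain ⟨n, hn⟩ := hKc.exists_isGreatest hne
        exact ⟨l, n, fun x hx => ⟨hl.2 hx, hn.2 hx⟩,
          fun x hx => ⟨(hKab hl.1).1.trans_le hx.1, hx.2.trans_lt (hKab hn.1).2⟩⟩
    have hφ0 : ∀ x ∉ Icc l n, φ x = 0 := fun x hx => by
      rcases lt_or_ge x l with hxl | hxl
      · refine setIntegral_eq_zero_of_forall_eq_zero fun t ht => hθ0 t fun htK => ?_
        exact absurd (hKln htK).1 (by simp at ht; linarith)
      · have hxn : n < x := by
          by_contra hcon
          exact hx ⟨hxl, not_lt.1 hcon⟩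
        -- To the right of the support the primitive equals the full integral of θ, which is zero.
        rw [← hθint]
        refine setIntegral_eq_integral_of_forall_compl_eq_zero fun t ht => hθ0 t fun htK => ?_
        exact absurd (hKln htK).2 (by simp at ht; linarith)
    have hφt : tsupport φ ⊆ Icc l n := closure_minimal (fun x hx => by
      by_contra hcon
      exact hx (hφ0 x hcon)) isClosed_Icc
    have hφc : HasCompactSupport φ := isCompact_Icc.of_isClosed_subset (isClosed_tsupport φ) hφt
    have key := h.integral_eq φ hφs hφc (hφt.trans hln)
    have i1 := integrableOn_mul_test h.locallyIntegrable hψ.continuous.continuousOn hψc hψs z0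
    have i2 := integrableOn_mul_test h.locallyIntegrable hρd.continuous.continuousOn hρc hρs z0
    have e1 : ∫ x in Ioo a b, u x * deriv φ x
        = (∫ x in Ioo a b, u x * ψ x) - c * k := by
      rw [hφ', hk, ← integral_const_mul, ← integral_sub i1 (i2.const_mul c)]
      congr 1 with x
      simp only [hθ]; ring
    have e2 : ∫ x in Ioo a b, ψ x = c :=
      setIntegral_eq_integral_of_forall_compl_eq_zero fun x hx => z0 x fun h => hx (hψs h)
    have e3 : ∫ x, ψ x • (u - fun _ : ℝ => k) x = ∫ x in Ioo a b, (u x * ψ x - k * ψ x) := by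
      rw [← setIntegral_eq_integral_of_forall_compl_eq_zero (s := Ioo a b)]
      · congr 1 with x
        simp; ring
      · intro x hx
        simp [z0 x fun h => hx (hψs h)]
    rw [e3, integral_sub i1
      ((hψ.continuous.integrable_of_hasCompactSupport hψc).const_mul k).integrableOn,
      integral_const_mul, e2]
    rw [e1] at key
    simp at key
    linarith

/-- A continuous function with a continuous weak derivative is classically differentiable. -/
theorem hasDerivAt (hu : ContinuousOn u (Ioo a b)) (hv : ContinuousOn v (Ioo a b))
    (h : IsWeakDeriv a b u v) {x : ℝ} (hx : x ∈ Ioo a b) : HasDerivAt u (v x) x := by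
  have hW : ∀ y ∈ Ioo a b, HasDerivAt (fun y => ∫ t in x..y, v t) (v y) y := fun y hy =>
    intervalIntegral.integral_hasDerivAt_right
      (h.locallyIntegrable_deriv.intervalIntegrable_of_mem_Ioo hx hy)
      (hv.stronglyMeasurableAtFilter isOpen_Ioo y hy) (hv.continuousAt (isOpen_Ioo.mem_nhds hy))
  have hP := IsLocPrimitive.of_hasDerivAt hW hv
  -- u and the classical primitive of v have the same weak derivative, so they differ by a constant.
  have h0 := h.sub hP.isWeakDeriv
  simp only [sub_self] at h0
  obtain ⟨k, hk⟩ := exists_eq_const (hu.sub hP.continuousOn) h0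
  refine ((hW x hx).add_const k).congr_of_eventuallyEq ?_
  filter_upwards [isOpen_Ioo.mem_nhds hx] with y hy
  have := hk y hy
  simp only [Pi.sub_apply] at this
  linarith

end IsWeakDeriv

/-! ### The regular solution of the homogeneous equation -/

/-- The coefficients of the power series in `x ^ β` of the solution of `(x^{2-β} φ')' = φ` that is
regular at the origin. -/
noncomputable def regularCoeff (β : ℝ) (n : ℕ) : ℝ :=
  ∏ i ∈ Finset.range n, (((i : ℝ) * β + 1) * (((i : ℝ) + 1) * β))⁻¹

section regularCoeff

variable {β : ℝ}

theorem regularCoeff_zero : regularCoeff β 0 = 1 := by simp [regularCoeff]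

theorem regularCoeff_nonneg (hβ : 0 < β) (n : ℕ) : 0 ≤ regularCoeff β n :=
  Finset.prod_nonneg fun i _ => by positivity

/-- This recurrence is the coefficientwise form of φ' = x^{β-2} ψ, where ψ is the primitive of φ. -/
theorem regularCoeff_succ_mul (hβ : 0 < β) (n : ℕ) :
    regularCoeff β (n + 1) * (((n : ℝ) + 1) * β) = regularCoeff β n / ((n : ℝ) * β + 1) := by
  rw [regularCoeff, Finset.prod_range_succ, ← regularCoeff]
  have : (n : ℝ) * β + 1 ≠ 0 := by positivity
  field_simp

theorem regularCoeff_div_le (hβ : 0 < β) (n : ℕ) :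
    regularCoeff β n / ((n : ℝ) * β + 1) ≤ regularCoeff β n :=
  div_le_self (regularCoeff_nonneg hβ n) (by have : 0 ≤ (n : ℝ) * β := by positivity
                                             linarith)

/-- Discarding the factors iβ + 1 ≥ 1 leaves at most β^{-n} / n! for the coefficient, so the series
is dominated by an exponential series. -/
theorem regularCoeff_mul_pow_le (hβ : 0 < β) {R : ℝ} (hR : 0 ≤ R) (n : ℕ) :
    regularCoeff β n * R ^ n ≤ (R / β) ^ n / (n.factorial : ℝ) := by
  induction n with
  | zero => simp [regularCoeff_zero]
  | succ n ih =>
    have h1 : regularCoeff β (n + 1) ≤ regularCoeff β n / (((n : ℝ) + 1) * β) := by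
      rw [le_div_iff₀ (by positivity), regularCoeff_succ_mul hβ]
      exact regularCoeff_div_le hβ n
    calc regularCoeff β (n + 1) * R ^ (n + 1)
        ≤ regularCoeff β n / (((n : ℝ) + 1) * β) * R ^ (n + 1) := by gcongr
      _ = (regularCoeff β n * R ^ n) * (R / (((n : ℝ) + 1) * β)) := by rw [pow_succ]; field_simp
      _ ≤ ((R / β) ^ n / (n.factorial : ℝ)) * (R / (((n : ℝ) + 1) * β)) := by gcongr
      _ = _ := by rw [pow_succ, Nat.factorial_succ]; push_cast; field_simp

theorem summable_regularCoeff_mul_pow (hβ : 0 < β) {R : ℝ} (hR : 0 ≤ R) :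
    Summable fun n => regularCoeff β n * R ^ n :=
  .of_nonneg_of_le (fun n => mul_nonneg (regularCoeff_nonneg hβ n) (by positivity))
    (regularCoeff_mul_pow_le hβ hR) (Real.summable_pow_div_factorial _)

theorem rpow_natCast_mul' {x : ℝ} (hx : 0 ≤ x) (n : ℕ) : x ^ ((n : ℝ) * β) = (x ^ β) ^ n := by
  rw [mul_comm, Real.rpow_mul hx, Real.rpow_natCast]

theorem summable_regularCoeff_mul_rpow (hβ : 0 < β) {x : ℝ} (hx : 0 ≤ x) :
    Summable fun n : ℕ => regularCoeff β n * x ^ ((n : ℝ) * β) := by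
  simp only [rpow_natCast_mul' hx]
  exact summable_regularCoeff_mul_pow hβ (by positivity)

/-- After shifting the index, the recurrence absorbs the factor nβ and the undifferentiated series
times x^β is a majorant. -/
theorem summable_regularCoeff_mul_rpow_mul (hβ : 0 < β) {x : ℝ} (hx : 0 ≤ x) :
    Summable fun n : ℕ => regularCoeff β n * ((n : ℝ) * β) * x ^ ((n : ℝ) * β) := by
  rw [← summable_nat_add_iff 1]
  refine .of_nonneg_of_le (fun n => ?_) (fun n => ?_)
    ((summable_regularCoeff_mul_rpow hβ hx).mul_left (x ^ β))
  · exact mul_nonneg (mul_nonneg (regularCoeff_nonneg hβ _) (by positivity)) (by positivity)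
  · push_cast
    rw [regularCoeff_succ_mul hβ]
    calc _ ≤ regularCoeff β n * x ^ (((n : ℝ) + 1) * β) := by
          gcongr; exact regularCoeff_div_le hβ n
      _ = _ := by
          rw [add_mul, one_mul, Real.rpow_add_of_nonneg hx (by positivity) hβ.le]; ring

/-- The solution of `(x^{2-β} φ')' = φ` that is regular at the origin. -/
noncomputable def regularSol (β x : ℝ) : ℝ := ∑' n : ℕ, regularCoeff β n * x ^ ((n : ℝ) * β)

/-- The primitive of `regularSol` vanishing at the origin. -/
noncomputable def regularSolPrim (β x : ℝ) : ℝ :=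
  ∑' n : ℕ, regularCoeff β n / ((n : ℝ) * β + 1) * x ^ ((n : ℝ) * β + 1)

theorem hasDerivAt_regularSol (hβ : 0 < β) {x : ℝ} (hx : 0 < x) :
    HasDerivAt (regularSol β) (x ^ (β - 2) * regularSolPrim β x) x := by
  -- On this neighbourhood y^{nβ} ≤ (2x)^{nβ} and 1/y ≤ 2/x, which gives a summable majorant for the
  -- derivatives and allows termwise differentiation.
  have hxm : x ∈ Ioo (x / 2) (2 * x) := ⟨by linarith, by linarith⟩
  have key := hasDerivAt_tsum_of_isPreconnected (𝕜 := ℝ) (y := x) (y₀ := x)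
    (g := fun (n : ℕ) y => regularCoeff β n * y ^ ((n : ℝ) * β))
    (g' := fun n y => regularCoeff β n * (((n : ℝ) * β) * y ^ ((n : ℝ) * β - 1)))
    (((summable_regularCoeff_mul_rpow_mul hβ (x := 2 * x) (by positivity)).mul_right (2 / x)))
    (isOpen_Ioo (a := x / 2) (b := 2 * x)) isPreconnected_Ioo
    (fun n y hy => ?_) (fun n y hy => ?_) hxm (summable_regularCoeff_mul_rpow hβ hx.le) hxm
  · refine key.congr_deriv ?_
    have hs : Summable fun n : ℕ =>
        regularCoeff β n * (((n : ℝ) * β) * x ^ ((n : ℝ) * β - 1)) := by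
      refine ((summable_regularCoeff_mul_rpow_mul hβ hx.le).mul_right x⁻¹).congr fun n => ?_
      rw [Real.rpow_sub_one hx.ne']; ring
    rw [hs.tsum_eq_zero_add, regularSolPrim, ← tsum_mul_left]
    simp only [CharP.cast_eq_zero, zero_mul, mul_zero, zero_add]
    refine tsum_congr fun n => ?_
    push_cast
    rw [← mul_assoc, regularCoeff_succ_mul hβ, mul_left_comm, ← Real.rpow_add hx]
    congr 2; ring
  · have hy0 : y ≠ 0 := by linarith [hy.1]
    exact (Real.hasDerivAt_rpow_const (Or.inl hy0)).const_mul _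
  · have hy0 : 0 < y := by linarith [hy.1]
    have hc := regularCoeff_nonneg hβ n
    rw [Real.norm_of_nonneg (by positivity), Real.rpow_sub_one hy0.ne']
    have h1 : y ^ ((n : ℝ) * β) ≤ (2 * x) ^ ((n : ℝ) * β) :=
      Real.rpow_le_rpow hy0.le hy.2.le (by positivity)
    have h2 : 1 / y ≤ 2 / x := by
      rw [div_le_div_iff₀ hy0 hx]; linarith [hy.1]
    calc regularCoeff β n * ((n : ℝ) * β * (y ^ ((n : ℝ) * β) / y))
        = regularCoeff β n * ((n : ℝ) * β) * y ^ ((n : ℝ) * β) * (1 / y) := by ring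
      _ ≤ _ := by gcongr

theorem summable_regularSolPrim (hβ : 0 < β) {x : ℝ} (hx : 0 < x) :
    Summable fun n : ℕ => regularCoeff β n / ((n : ℝ) * β + 1) * x ^ ((n : ℝ) * β + 1) := by
  refine .of_nonneg_of_le (fun n => ?_) (fun n => ?_)
    ((summable_regularCoeff_mul_rpow hβ hx.le).mul_right x)
  · have := regularCoeff_nonneg hβ n
    positivity
  · rw [Real.rpow_add_one hx.ne', ← mul_assoc]
    gcongr
    exact regularCoeff_div_le hβ n

theorem hasDerivAt_regularSolPrim (hβ : 0 < β) {x : ℝ} (hx : 0 < x) :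
    HasDerivAt (regularSolPrim β) (regularSol β x) x := by
  have hxm : x ∈ Ioo (x / 2) (2 * x) := ⟨by linarith, by linarith⟩
  refine hasDerivAt_tsum_of_isPreconnected (𝕜 := ℝ) (y := x) (y₀ := x)
    (g := fun (n : ℕ) y => regularCoeff β n / ((n : ℝ) * β + 1) * y ^ ((n : ℝ) * β + 1))
    (g' := fun n y => regularCoeff β n * y ^ ((n : ℝ) * β))
    (summable_regularCoeff_mul_rpow hβ (x := 2 * x) (by positivity))
    (isOpen_Ioo (a := x / 2) (b := 2 * x)) isPreconnected_Ioo
    (fun n y hy => ?_) (fun n y hy => ?_) hxm (summable_regularSolPrim hβ hx) hxm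
  · have hy0 : y ≠ 0 := by linarith [hy.1]
    have hn : (n : ℝ) * β + 1 ≠ 0 := by positivity
    refine ((Real.hasDerivAt_rpow_const (p := (n : ℝ) * β + 1) (Or.inl hy0)).const_mul
      (regularCoeff β n / ((n : ℝ) * β + 1))).congr_deriv ?_
    rw [add_sub_cancel_right]
    field_simp
  · have hy0 : 0 < y := by linarith [hy.1]
    have hc := regularCoeff_nonneg hβ n
    rw [Real.norm_of_nonneg (by positivity)]
    gcongr
    exact hy.2.le

theorem one_le_regularSol (hβ : 0 < β) {x : ℝ} (hx : 0 < x) : 1 ≤ regularSol β x := by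
  refine le_trans ?_ ((summable_regularCoeff_mul_rpow hβ hx.le).le_tsum 0 fun n _ =>
    mul_nonneg (regularCoeff_nonneg hβ n) (by positivity))
  simp [regularCoeff_zero]

theorem regularSol_le (hβ : 0 < β) {x : ℝ} (hx : 0 < x) (hx1 : x ≤ 1) :
    regularSol β x ≤ regularSol β 1 :=
  (summable_regularCoeff_mul_rpow hβ hx.le).tsum_le_tsum
    (fun n => mul_le_mul_of_nonneg_left (Real.rpow_le_rpow hx.le hx1 (by positivity))
      (regularCoeff_nonneg hβ n)) (summable_regularCoeff_mul_rpow hβ zero_le_one)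

theorem regularSolPrim_nonneg (hβ : 0 < β) {x : ℝ} (hx : 0 < x) : 0 ≤ regularSolPrim β x :=
  tsum_nonneg fun n => by
    have := regularCoeff_nonneg hβ n
    positivity

theorem regularSolPrim_le (hβ : 0 < β) {x : ℝ} (hx : 0 < x) (hx1 : x ≤ 1) :
    regularSolPrim β x ≤ regularSol β 1 * x := by
  refine le_trans ?_ (mul_le_mul_of_nonneg_right (regularSol_le hβ hx hx1) hx.le)
  rw [regularSol, ← tsum_mul_right]
  refine (summable_regularSolPrim hβ hx).tsum_le_tsum (fun n => ?_)
    ((summable_regularCoeff_mul_rpow hβ hx.le).mul_right x)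
  rw [Real.rpow_add_one hx.ne', ← mul_assoc]
  gcongr
  exact regularCoeff_div_le hβ n

end regularCoeff

/-! ### Existence by reduction of order -/

theorem intervalIntegrable_rpow_of_pos {x y : ℝ} (hx : 0 < x) (hy : 0 < y) (s : ℝ) :
    IntervalIntegrable (fun t : ℝ => t ^ s) volume x y :=
  intervalIntegral.intervalIntegrable_rpow (Or.inr fun h =>
    (((lt_min hx hy).trans_le h.1).false))

/-- The tails of `t ^ (β - 1 - r)`, `β > 0`, are dominated by a power larger than `-r`. -/
theorem integral_rpow_tail_le {β r x : ℝ} (hr : 0 < r) (hx : 0 < x) (hx1 : x ≤ 1) :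
    ∫ t in x..1, t ^ (β - 1 - r) ≤ (r - min β (r / 2))⁻¹ * x ^ (min β (r / 2) - r) := by
  -- Lowering β to at most r/2 keeps γ < r, so the logarithmic case β = r and the bounded case β > r
  -- need no separate treatment.
  set γ := min β (r / 2) with hγ
  have hγr : γ < r := (min_le_right _ _).trans_lt (by linarith)
  have hγβ : γ ≤ β := min_le_left _ _
  calc ∫ t in x..1, t ^ (β - 1 - r) ≤ ∫ t in x..1, t ^ (γ - 1 - r) := by
        refine intervalIntegral.integral_mono_on hx1
          (intervalIntegrable_rpow_of_pos hx one_pos _)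
          (intervalIntegrable_rpow_of_pos hx one_pos _) fun t ht => ?_
        exact Real.rpow_le_rpow_of_exponent_ge (hx.trans_le ht.1) ht.2 (by linarith)
    _ = (r - γ)⁻¹ * (x ^ (γ - r) - 1) := by
        rw [integral_rpow (Or.inr ⟨by linarith, fun h => ?_⟩)]
        · rw [show γ - 1 - r + 1 = γ - r by ring, Real.one_rpow]
          have : r - γ ≠ 0 := by linarith
          have : γ - r ≠ 0 := by linarith
          grind
        · rw [uIcc_of_le hx1] at h; linarith [h.1]
    _ ≤ _ := by
        have : 0 ≤ (r - γ)⁻¹ := by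
          rw [inv_nonneg]; linarith
        gcongr
        linarith

/-- The ansatz u = φ v reduces the equation to two quadratures. The last clause is stated for
arbitrary r and N, with M independent of f, so that it can be applied with r = 1/p and N = ‖f‖_p. -/
theorem exists_regular_solution {α : ℝ} (hα : α < 1) :
    ∃ M : ℝ, 0 ≤ M ∧ ∀ f : ℝ → ℝ, IntegrableOn f (Ioo 0 1) → ∃ u w : ℝ → ℝ,
      (∀ x, 0 < x → HasDerivAt u (x ^ (-(2 * α)) * w x) x) ∧ ContinuousOn w (Ioi 0) ∧
      IsLocPrimitive 0 1 w (fun x => u x - f x) ∧ Tendsto w (𝓝[>] 0) (𝓝 0) ∧ u 1 = 0 ∧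
      ∀ r N : ℝ, (∀ t ∈ Ioc (0 : ℝ) 1, ∫ s in (0 : ℝ)..t, |f s| ≤ N * t ^ (1 - r)) →
        ∀ x ∈ Ioc (0 : ℝ) 1, |u x| ≤ M * N * ∫ t in x..1, t ^ ((2 - 2 * α) - 1 - r) := by
  set β := 2 - 2 * α with hβdef
  have hβ : 0 < β := by linarith
  set φ := regularSol β with hφ
  set ψ := regularSolPrim β with hψ
  set M := φ 1 with hM
  have hφ1 : ∀ x, 0 < x → 1 ≤ φ x := fun x hx => one_le_regularSol hβ hx
  have hφ0 : ∀ x, 0 < x → φ x ≠ 0 := fun x hx => by linarith [hφ1 x hx]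
  have hφM : ∀ x, 0 < x → x ≤ 1 → φ x ≤ M := fun x hx hx1 => regularSol_le hβ hx hx1
  have hM1 : 1 ≤ M := hφ1 1 one_pos
  have hφd : ∀ x, 0 < x → HasDerivAt φ (x ^ (-(2 * α)) * ψ x) x := fun x hx => by
    have := hasDerivAt_regularSol hβ hx
    rwa [show β - 2 = -(2 * α) by rw [hβdef]; ring] at this
  have hψd : ∀ x, 0 < x → HasDerivAt ψ (φ x) x := fun x hx => hasDerivAt_regularSolPrim hβ hx
  have hφc : ContinuousOn φ (Ioi 0) := fun x hx => (hφd x hx).continuousAt.continuousWithinAt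
  have hψc : ContinuousOn ψ (Ioi 0) := fun x hx => (hψd x hx).continuousAt.continuousWithinAt
  have hpc : ContinuousOn (fun x : ℝ => x ^ (-(2 * α))) (Ioi 0) := fun x hx =>
    (Real.continuousAt_rpow_const _ _ (Or.inl (ne_of_gt hx))).continuousWithinAt
  refine ⟨M * M, by positivity, fun f hf => ?_⟩
  have hk : IntegrableOn (fun x => f x * φ x) (Ioo 0 1) := by
    refine Integrable.mul_bdd (c := M) hf
      ((hφc.mono Ioo_subset_Ioi_self).aestronglyMeasurable measurableSet_Ioo) ?_
    filter_upwards [ae_restrict_mem measurableSet_Ioo] with x hx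
    rw [Real.norm_of_nonneg (by linarith [hφ1 x hx.1])]
    exact hφM x hx.1 hx.2.le
  -- Extending f φ by zero makes its primitive F continuous on the whole line, in particular at 0,
  -- where F = 0.
  set k := (Ioo (0 : ℝ) 1).indicator (fun x => f x * φ x) with hkdef
  have hki : Integrable k := (integrable_indicator_iff measurableSet_Ioo).2 hk
  set F : ℝ → ℝ := fun x => ∫ t in (0 : ℝ)..x, k t with hF
  have hFc : Continuous F := intervalIntegral.continuous_primitive
    (fun a b => hki.intervalIntegrable) 0
  have hF0 : F 0 = 0 := by simp [hF]
  have hFP : IsLocPrimitive 0 1 F (fun x => f x * φ x) := by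
    refine (IsLocPrimitive.of_integral zero_le_one hki.integrableOn).congr_ae
      (.of_forall fun x hx => ?_)
    rw [hkdef, indicator_of_mem hx]
  have hFb : ∀ t ∈ Ioc (0 : ℝ) 1, |F t| ≤ M * ∫ s in (0 : ℝ)..t, |f s| := fun t ht => by
    rw [← intervalIntegral.integral_const_mul]
    have hfi : IntervalIntegrable f volume 0 t := by
      rw [intervalIntegrable_iff_integrableOn_Ioo_of_le ht.1.le]
      exact hf.mono_set (Ioo_subset_Ioo_right ht.2)
    refine intervalIntegral.norm_integral_le_of_norm_le (f := k) (μ := volume) ht.1.le ?_ (hfi.abs.const_mul M)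
    refine .of_forall fun s hs => ?_
    rw [hkdef]
    by_cases hs1 : s ∈ Ioo (0 : ℝ) 1
    · rw [indicator_of_mem hs1, norm_mul, mul_comm, Real.norm_eq_abs, Real.norm_eq_abs,
        abs_of_nonneg (by linarith [hφ1 s hs1.1] : 0 ≤ φ s)]
      gcongr
      exact hφM s hs1.1 hs1.2.le
    · rw [indicator_of_notMem hs1, norm_zero]
      positivity
  -- This is -v', as dictated by x^{2α} φ² v' = -F.
  set h : ℝ → ℝ := fun t => t ^ (-(2 * α)) * ((φ t)⁻¹ * (φ t)⁻¹ * F t) with hh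
  have hic : ContinuousOn (fun x => (φ x)⁻¹) (Ioi 0) := hφc.inv₀ fun x hx => hφ0 x hx
  have hhc : ContinuousOn h (Ioi 0) := hpc.mul ((hic.mul hic).mul hFc.continuousOn)
  set v : ℝ → ℝ := fun x => ∫ t in x..1, h t with hv
  have hhi : ∀ x, 0 < x → IntervalIntegrable h volume x 1 := fun x hx =>
    (hhc.mono (ordConnected_Ioi.uIcc_subset hx (mem_Ioi.2 one_pos))).intervalIntegrable
  have hvd : ∀ x, 0 < x → HasDerivAt v (-h x) x := fun x hx =>
    intervalIntegral.integral_hasDerivAt_left (hhi x hx)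
      (hhc.stronglyMeasurableAtFilter isOpen_Ioi x hx) (hhc.continuousAt (Ioi_mem_nhds hx))
  have hvc : ContinuousOn v (Ioi 0) := fun x hx => (hvd x hx).continuousAt.continuousWithinAt
  have hvb : ∀ r N : ℝ, (∀ t ∈ Ioc (0 : ℝ) 1, ∫ s in (0 : ℝ)..t, |f s| ≤ N * t ^ (1 - r)) →
      ∀ x ∈ Ioc (0 : ℝ) 1, |v x| ≤ M * N * ∫ t in x..1, t ^ (β - 1 - r) := by
    intro r N hN x hx
    rw [← intervalIntegral.integral_const_mul]
    refine intervalIntegral.norm_integral_le_of_norm_le (f := h) (μ := volume) hx.2 (.of_forall fun t ht => ?_)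
      ((intervalIntegrable_rpow_of_pos hx.1 one_pos _).const_mul _)
    have ht0 : 0 < t := hx.1.trans ht.1
    have hinv : ‖(φ t)⁻¹‖ ≤ 1 := by
      rw [norm_inv, Real.norm_of_nonneg (by linarith [hφ1 t ht0])]
      exact inv_le_one_of_one_le₀ (hφ1 t ht0)
    have hFt : ‖F t‖ ≤ M * (N * t ^ (1 - r)) := (hFb t ⟨ht0, ht.2⟩).trans (by
      gcongr; exact hN t ⟨ht0, ht.2⟩)
    rw [hh]
    simp only [norm_mul]
    rw [Real.norm_of_nonneg (by positivity : 0 ≤ t ^ (-(2 * α)))]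
    calc t ^ (-(2 * α)) * (‖(φ t)⁻¹‖ * ‖(φ t)⁻¹‖ * ‖F t‖)
        ≤ t ^ (-(2 * α)) * (1 * 1 * (M * (N * t ^ (1 - r)))) := by gcongr
      _ = M * N * (t ^ (-(2 * α)) * t ^ (1 - r)) := by ring
      _ = M * N * t ^ (β - 1 - r) := by
        rw [← Real.rpow_add ht0]; congr 2; rw [hβdef]; ring
  have hid : ∀ x, 0 < x →
      HasDerivAt (fun x => (φ x)⁻¹) (-(x ^ (-(2 * α)) * ψ x) / φ x ^ 2) x := fun x hx =>
    (hφd x hx).inv (hφ0 x hx)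
  have hsub : Ioo (0 : ℝ) 1 ⊆ Ioi 0 := Ioo_subset_Ioi_self
  -- The flux of φ v is ψ v + x^{2α} φ v' = ψ v - F/φ. In its derivative the terms containing F
  -- cancel and φ v - f remains.
  refine ⟨fun x => φ x * v x, fun x => ψ x * v x - F x * (φ x)⁻¹, fun x hx => ?_, ?_, ?_, ?_, ?_, ?_⟩
  · refine ((hφd x hx).mul (hvd x hx)).congr_deriv ?_
    have := hφ0 x hx
    simp only [hh]
    field_simp
    ring
  · exact (hψc.mul hvc).sub (hFc.continuousOn.mul hic)
  · have p1 : IsLocPrimitive 0 1 ψ φ := .of_hasDerivAt (fun x hx => hψd x hx.1) (hφc.mono hsub)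
    have p2 : IsLocPrimitive 0 1 v (fun x => -h x) :=
      .of_hasDerivAt (fun x hx => hvd x hx.1) (hhc.mono hsub).neg
    have p3 : IsLocPrimitive 0 1 (fun x => (φ x)⁻¹) (fun x => -(x ^ (-(2 * α)) * ψ x) / φ x ^ 2) :=
      .of_hasDerivAt (fun x hx => hid x hx.1) (((hpc.mul hψc).neg.div (hφc.pow 2)
        fun x hx => pow_ne_zero 2 (hφ0 x hx)).mono hsub)
    refine ((p1.mul p2).sub (hFP.mul p3)).congr_ae (.of_forall fun x hx => ?_)
    have := hφ0 x hx.1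
    simp only [hh]
    field_simp
    ring
  · have t1 : Tendsto (fun x => ψ x * v x) (𝓝[>] 0) (𝓝 0) := by
      set N := ∫ s in (0 : ℝ)..1, |f s| with hN
      -- The crude choice r = 1 needs only f ∈ L¹ and gives v = O(x^{γ-1}) with γ > 0; as ψ = O(x),
      -- the product is O(x^γ).
      have hb := hvb 1 N fun t ht => by
        rw [sub_self, Real.rpow_zero, mul_one]
        have hfi : IntervalIntegrable (fun s => |f s|) volume 0 1 := by
          rw [intervalIntegrable_iff_integrableOn_Ioo_of_le zero_le_one]
          exact hf.abs
        refine intervalIntegral.integral_mono_interval le_rfl ht.1.le ht.2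
          (.of_forall fun s => abs_nonneg _) hfi
      have hN0 : 0 ≤ N := intervalIntegral.integral_nonneg zero_le_one fun s _ => abs_nonneg _
      set γ := min β (1 / 2) with hγ
      have hγ0 : 0 < γ := lt_min hβ (by norm_num)
      have hlim : Tendsto (fun x : ℝ => M * (M * N * (1 - γ)⁻¹) * x ^ γ) (𝓝[>] 0) (𝓝 0) := by
        have : Tendsto (fun x : ℝ => x ^ γ) (𝓝[>] 0) (𝓝 0) := by
          have := (Real.continuousAt_rpow_const 0 γ (Or.inr hγ0.le)).tendsto
          rw [Real.zero_rpow hγ0.ne'] at this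
          exact this.mono_left nhdsWithin_le_nhds
        simpa using this.const_mul (M * (M * N * (1 - γ)⁻¹))
      refine squeeze_zero_norm' ?_ hlim
      filter_upwards [Ioo_mem_nhdsGT one_pos] with x hx
      have h1 := regularSolPrim_le hβ hx.1 hx.2.le
      have h0 := regularSolPrim_nonneg hβ hx.1
      have h2 := hb x (Ioo_subset_Ioc_self hx)
      have h3 := integral_rpow_tail_le (β := β) one_pos hx.1 hx.2.le
      rw [norm_mul, Real.norm_of_nonneg h0, Real.norm_eq_abs]
      calc ψ x * |v x| ≤ (M * x) * (M * N * ((1 - γ)⁻¹ * x ^ (γ - 1))) := by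
            refine mul_le_mul h1 (h2.trans ?_) (abs_nonneg _) (mul_nonneg (by linarith) hx.1.le)
            exact mul_le_mul_of_nonneg_left h3 (mul_nonneg (by linarith) hN0)
        _ = M * (M * N * (1 - γ)⁻¹) * (x ^ (γ - 1) * x) := by ring
        _ = _ := by rw [← Real.rpow_add_one hx.1.ne', sub_add_cancel]
    have t2 : Tendsto (fun x => F x * (φ x)⁻¹) (𝓝[>] 0) (𝓝 0) := by
      have hl : Tendsto (fun x => |F x|) (𝓝[>] 0) (𝓝 0) := by
        have := hFc.abs.tendsto 0
        rw [hF0, abs_zero] at this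
        exact this.mono_left nhdsWithin_le_nhds
      refine squeeze_zero_norm' ?_ hl
      filter_upwards [self_mem_nhdsWithin] with x hx
      rw [norm_mul, Real.norm_eq_abs, norm_inv, Real.norm_of_nonneg (by linarith [hφ1 x hx])]
      exact mul_le_of_le_one_right (abs_nonneg _) (inv_le_one_of_one_le₀ (hφ1 x hx))
    simpa using t1.sub t2
  · simp [hv]
  · intro r N hN x hx
    have h1 := hvb r N hN x hx
    rw [abs_mul, abs_of_nonneg (by linarith [hφ1 x hx.1] : 0 ≤ φ x)]
    calc φ x * |v x| ≤ M * (M * N * ∫ t in x..1, t ^ (β - 1 - r)) :=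
          mul_le_mul (hφM x hx.1 hx.2) h1 (abs_nonneg _) (by linarith)
      _ = _ := by ring

/-! ### Hölder bounds and power weights in L^p(0, 1) -/

theorem volIoo_le_of_subset {a b c d : ℝ} (h : Ioo a b ⊆ Ioo c d) : volIoo a b ≤ volIoo c d :=
  Measure.restrict_mono h le_rfl

theorem MeasureTheory.MemLp.integrableOn_Ioo {a b : ℝ} {p : ℝ≥0∞} (hp : 1 ≤ p) {g : ℝ → ℝ}
    (hg : MemLp g p (volIoo a b)) : IntegrableOn g (Ioo a b) :=
  hg.integrable hp

/-- Hölder's inequality on `(0, t)`. -/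
theorem integral_abs_le_eLpNorm_mul_rpow {p : ℝ≥0∞} (hp : 1 ≤ p) {t : ℝ} (ht : 0 ≤ t) {g : ℝ → ℝ}
    (hg : MemLp g p (volIoo 0 t)) :
    ∫ s in (0 : ℝ)..t, |g s| ≤ (eLpNorm g p (volIoo 0 t)).toReal * t ^ (1 - 1 / p.toReal) := by
  have h1 := eLpNorm_le_eLpNorm_mul_rpow_measure_univ hp hg.1
  have hv : volIoo 0 t univ = ENNReal.ofReal t := by simp
  have h2 : ∫ s in (0 : ℝ)..t, |g s| = (eLpNorm g 1 (volIoo 0 t)).toReal := by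
    rw [intervalIntegral.integral_of_le ht, integral_Ioc_eq_integral_Ioo,
      eLpNorm_one_eq_lintegral_enorm, integral_eq_lintegral_of_nonneg_ae
        (.of_forall fun s => abs_nonneg _) hg.1.norm]
    simp only [← Real.norm_eq_abs, ofReal_norm]
  have hexp : (0 : ℝ) ≤ 1 - 1 / p.toReal := by
    rcases eq_or_ne p ⊤ with rfl | hpt
    · simp
    · have : 1 ≤ p.toReal := by
        simpa using ENNReal.toReal_mono hpt hp
      rw [sub_nonneg, div_le_one (by linarith)]
      exact this
  rw [hv, ENNReal.toReal_one, div_one, ENNReal.ofReal_rpow_of_nonneg ht hexp] at h1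
  rw [h2]
  refine (ENNReal.toReal_mono (ENNReal.mul_ne_top hg.2.ne ENNReal.ofReal_ne_top) h1).trans ?_
  rw [ENNReal.toReal_mul, ENNReal.toReal_ofReal (by positivity)]

theorem memLp_rpow_Ioo {p : ℝ≥0∞} (hp : 1 ≤ p) (hpt : p ≠ ⊤) {s : ℝ} (hs : -1 < s * p.toReal) :
    MemLp (fun x : ℝ => x ^ s) p (volIoo 0 1) := by
  have hp0 : p ≠ 0 := (zero_lt_one.trans_le hp).ne'
  have hm : AEStronglyMeasurable (fun x : ℝ => x ^ s) (volIoo 0 1) :=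
    (measurable_id.pow_const s).aestronglyMeasurable
  rw [← integrable_norm_rpow_iff hm hp0 hpt]
  have hI : IntegrableOn (fun x : ℝ => x ^ (s * p.toReal)) (Ioo 0 1) := by
    rw [← intervalIntegrable_iff_integrableOn_Ioo_of_le zero_le_one]
    exact intervalIntegral.intervalIntegrable_rpow' hs
  refine hI.congr ?_
  filter_upwards [ae_restrict_mem measurableSet_Ioo] with x hx
  have := hx.1
  rw [Real.norm_of_nonneg (by positivity), ← Real.rpow_mul hx.1.le]

/-- The tail is O(x^{γ-1/p}) with γ > 0 for finite p, which is p-integrable at 0, and bounded for p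
= ∞. -/
theorem exists_memLp_majorant_rpow_tail {β : ℝ} (hβ : 0 < β) {p : ℝ≥0∞} (hp : 1 ≤ p) :
    ∃ κ : ℝ → ℝ, MemLp κ p (volIoo 0 1) ∧
      ∀ x ∈ Ioo (0 : ℝ) 1, ∫ t in x..1, t ^ (β - 1 - 1 / p.toReal) ≤ κ x := by
  rcases eq_or_ne p ⊤ with rfl | hpt
  · refine ⟨fun _ => 1 / β, memLp_const _, fun x hx => ?_⟩
    -- Since `ENNReal.toReal ⊤ = 0` and division by zero gives 0, the expression `1 / p.toReal` has
    -- the intended value 0 at p = ∞.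
    rw [ENNReal.toReal_top, div_zero, sub_zero, integral_rpow (Or.inl (by linarith)),
      sub_add_cancel, Real.one_rpow]
    exact div_le_div_of_nonneg_right (by linarith [Real.rpow_nonneg hx.1.le β]) hβ.le
  · have hp1 : 1 ≤ p.toReal := by simpa using ENNReal.toReal_mono hpt hp
    have hr : 0 < 1 / p.toReal := by positivity
    set γ := min β (1 / p.toReal / 2) with hγ
    have hγ0 : 0 < γ := lt_min hβ (by positivity)
    refine ⟨fun x => (1 / p.toReal - γ)⁻¹ * x ^ (γ - 1 / p.toReal),
      (memLp_rpow_Ioo hp hpt ?_).const_mul _,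
      fun x hx => integral_rpow_tail_le hr hx.1 hx.2.le⟩
    rw [sub_mul, one_div, inv_mul_cancel₀ (by linarith)]
    have : 0 < γ * p.toReal := by positivity
    linarith

/-! ### Hardy's inequality -/

theorem lintegral_Ioo_rpow {x s : ℝ} (hx : 0 ≤ x) (hs : -1 < s) :
    ∫⁻ y in Ioo 0 x, ENNReal.ofReal (y ^ s) = ENNReal.ofReal (x ^ (s + 1) / (s + 1)) := by
  have hI : IntegrableOn (fun y : ℝ => y ^ s) (Ioo 0 x) := by
    rw [← intervalIntegrable_iff_integrableOn_Ioo_of_le hx]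
    exact intervalIntegral.intervalIntegrable_rpow' hs
  rw [← ofReal_integral_eq_lintegral_ofReal hI, ← integral_Ioc_eq_integral_Ioo,
    ← intervalIntegral.integral_of_le hx, integral_rpow (Or.inl hs),
    Real.zero_rpow (by linarith), sub_zero]
  filter_upwards [ae_restrict_mem measurableSet_Ioo] with y hy
  exact Real.rpow_nonneg hy.1.le _

theorem lintegral_Ioo_one_rpow_le {y s : ℝ} (hy : 0 < y) (hy1 : y ≤ 1) (hs : 0 < s) :
    ∫⁻ x in Ioo y 1, ENNReal.ofReal (x ^ (-1 - s)) ≤ ENNReal.ofReal (y ^ (-s) / s) := by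
  have hI : IntegrableOn (fun x : ℝ => x ^ (-1 - s)) (Ioo y 1) := by
    rw [← intervalIntegrable_iff_integrableOn_Ioo_of_le hy1]
    exact intervalIntegrable_rpow_of_pos hy one_pos _
  rw [← ofReal_integral_eq_lintegral_ofReal hI, ← integral_Ioc_eq_integral_Ioo,
    ← intervalIntegral.integral_of_le hy1, integral_rpow (Or.inr ⟨by linarith, fun h => ?_⟩)]
  · refine ENNReal.ofReal_le_ofReal ?_
    rw [show -1 - s + 1 = -s by ring, Real.one_rpow, div_neg, ← neg_div]
    gcongr
    linarith
  · rw [uIcc_of_le hy1] at h; linarith [h.1]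
  · filter_upwards [ae_restrict_mem measurableSet_Ioo] with x hx
    exact Real.rpow_nonneg (hy.trans hx.1).le _

/-- Weighted Hölder estimate behind Hardy's inequality. -/
theorem rpow_mul_lintegral_rpow_le {p q : ℝ} (hpq : p.HolderConjugate q) {x : ℝ} (hx : 0 < x)
    {G : ℝ → ℝ≥0∞} (hG : AEMeasurable G (volIoo 0 x)) :
    ENNReal.ofReal (x ^ (-p)) * (∫⁻ y in Ioo 0 x, G y) ^ p ≤
      ENNReal.ofReal (q ^ (p - 1)) * (ENNReal.ofReal (x ^ (-1 - 1 / q)) *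
        ∫⁻ y in Ioo 0 x, G y ^ p * ENNReal.ofReal (y ^ (1 / q))) := by
  have hp := hpq.pos
  have hq := hpq.symm.pos
  have hm : ∀ s : ℝ, Measurable fun y : ℝ => ENNReal.ofReal (y ^ s) := fun s =>
    (measurable_id.pow_const s).ennreal_ofReal
  have hpq1 : 1 / p + 1 / q = 1 := by simpa using hpq.inv_add_inv_eq_one
  have hpq2 : p / q = p - 1 := by
    field_simp at hpq1 ⊢
    nlinarith
  have key : ∫⁻ y in Ioo 0 x, G y ≤
      (∫⁻ y in Ioo 0 x, G y ^ p * ENNReal.ofReal (y ^ (1 / q))) ^ (1 / p) *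
        (ENNReal.ofReal (q * x ^ (1 / q))) ^ (1 / q) := by
    -- Hölder is applied after inserting y^{1/(pq)} y^{-1/(pq)}; the q-th power of the second factor
    -- is y^{-1/p}, whose integral over (0, x) is q x^{1/q}.
    have h1 := ENNReal.lintegral_mul_le_Lp_mul_Lq (volIoo 0 x) hpq
      (f := fun y => G y * ENNReal.ofReal (y ^ (1 / (p * q))))
      (g := fun y => ENNReal.ofReal (y ^ (-(1 / (p * q)))))
      (hG.mul (hm _).aemeasurable) (hm _).aemeasurable
    refine (le_of_eq ?_).trans (h1.trans (le_of_eq ?_))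
    · refine setLIntegral_congr_fun measurableSet_Ioo fun y hy => ?_
      have hy0 := hy.1
      simp only [Pi.mul_apply]
      rw [mul_assoc, ← ENNReal.ofReal_mul (by positivity), ← Real.rpow_add hy.1]
      simp
    · congr 1
      · congr 1
        refine setLIntegral_congr_fun measurableSet_Ioo fun y hy => ?_
        have hy0 := hy.1
        rw [ENNReal.mul_rpow_of_nonneg _ _ hp.le, ENNReal.ofReal_rpow_of_nonneg (by positivity) hp.le,
          ← Real.rpow_mul hy.1.le]
        congr 3
        field_simp
      · congr 1
        have : ∀ y ∈ Ioo 0 x, ENNReal.ofReal (y ^ (-(1 / (p * q)))) ^ q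
            = ENNReal.ofReal (y ^ (-(1 / p))) := fun y hy => by
          have hy0 := hy.1
          rw [ENNReal.ofReal_rpow_of_nonneg (by positivity) hq.le, ← Real.rpow_mul hy.1.le]
          congr 2
          field_simp
        rw [setLIntegral_congr_fun measurableSet_Ioo this,
          lintegral_Ioo_rpow hx.le (by linarith [show 0 < 1 / q by positivity]),
          show -(1 / p) + 1 = 1 / q by linarith]
        congr 1
        field_simp
  calc ENNReal.ofReal (x ^ (-p)) * (∫⁻ y in Ioo 0 x, G y) ^ p
      ≤ ENNReal.ofReal (x ^ (-p)) * ((∫⁻ y in Ioo 0 x, G y ^ p * ENNReal.ofReal (y ^ (1 / q))) ^ (1 / p) *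
        (ENNReal.ofReal (q * x ^ (1 / q))) ^ (1 / q)) ^ p := by gcongr
    _ = (ENNReal.ofReal (x ^ (-p)) * ENNReal.ofReal (q * x ^ (1 / q)) ^ (p - 1)) *
        ∫⁻ y in Ioo 0 x, G y ^ p * ENNReal.ofReal (y ^ (1 / q)) := by
      rw [ENNReal.mul_rpow_of_nonneg _ _ hp.le, ← ENNReal.rpow_mul, ← ENNReal.rpow_mul,
        one_div_mul_cancel hp.ne', ENNReal.rpow_one, one_div_mul_eq_div, hpq2]
      ring
    _ = _ := by
      have hp1 : 0 ≤ p - 1 := by linarith [hpq.lt]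
      rw [← mul_assoc, ENNReal.ofReal_rpow_of_nonneg (by positivity) hp1,
        ← ENNReal.ofReal_mul (by positivity), ← ENNReal.ofReal_mul (by positivity),
        Real.mul_rpow hq.le (by positivity), ← Real.rpow_mul hx.le, mul_left_comm,
        ← Real.rpow_add hx]
      congr 4
      field_simp at hpq1 hpq2 ⊢
      nlinarith

/-- Hardy's inequality on `(0, 1)`. -/
theorem lintegral_hardy_le {p q : ℝ} (hpq : p.HolderConjugate q)
    {G : ℝ → ℝ≥0∞} (hG : AEMeasurable G (volIoo 0 1)) :
    ∫⁻ x in Ioo 0 1, ENNReal.ofReal (x ^ (-p)) * (∫⁻ y in Ioo 0 x, G y) ^ p ≤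
      ENNReal.ofReal (q ^ p) * ∫⁻ y in Ioo 0 1, G y ^ p := by
  have hp := hpq.pos
  have hq := hpq.symm.pos
  have hm : ∀ s : ℝ, Measurable fun y : ℝ => ENNReal.ofReal (y ^ s) := fun s =>
    (measurable_id.pow_const s).ennreal_ofReal
  set T : ℝ → ℝ≥0∞ := fun y => G y ^ p * ENNReal.ofReal (y ^ (1 / q)) with hT
  have hTm : AEMeasurable T (volIoo 0 1) := (hG.pow_const p).mul (hm _).aemeasurable
  -- The double integral runs over the triangle y < x, ready for Tonelli.
  set D : Set (ℝ × ℝ) := {z | z.2 < z.1} with hD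
  have hDm : MeasurableSet D := measurableSet_lt measurable_snd measurable_fst
  set K : ℝ → ℝ → ℝ≥0∞ := fun x y =>
    D.indicator (fun z : ℝ × ℝ => ENNReal.ofReal (z.1 ^ (-1 - 1 / q)) * T z.2) (x, y) with hK
  have hKm : AEMeasurable (Function.uncurry K) ((volIoo 0 1).prod (volIoo 0 1)) :=
    (((hm _).comp measurable_fst).aemeasurable.mul hTm.comp_snd).indicator hDm
  have inner : ∀ x ∈ Ioo (0 : ℝ) 1, ENNReal.ofReal (x ^ (-1 - 1 / q)) * ∫⁻ y in Ioo 0 x, T y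
      = ∫⁻ y in Ioo 0 1, K x y := fun x hx => by
    rw [← lintegral_const_mul' _ _ ENNReal.ofReal_ne_top,
      show Ioo (0 : ℝ) x = Iio x ∩ Ioo 0 1 by
        ext y; simp only [mem_Ioo, mem_inter_iff, mem_Iio]
        exact ⟨fun h => ⟨h.2, h.1, h.2.trans hx.2⟩, fun h => ⟨h.2.1, h.1⟩⟩,
      ← Measure.restrict_restrict measurableSet_Iio, ← lintegral_indicator measurableSet_Iio]
    rfl
  have outer : ∀ y ∈ Ioo (0 : ℝ) 1, ∫⁻ x in Ioo 0 1, K x y ≤ ENNReal.ofReal q * G y ^ p :=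
    fun y hy => by
      have hy0 := hy.1
      have e : ∫⁻ x in Ioo 0 1, K x y = ∫⁻ x in Ioo y 1, ENNReal.ofReal (x ^ (-1 - 1 / q)) * T y := by
        rw [show Ioo y 1 = Ioi y ∩ Ioo 0 1 by
          ext x; simp only [mem_Ioo, mem_inter_iff, mem_Ioi]
          exact ⟨fun h => ⟨h.1, hy.1.trans h.1, h.2⟩, fun h => ⟨h.1, h.2.2⟩⟩,
          ← Measure.restrict_restrict measurableSet_Ioi, ← lintegral_indicator measurableSet_Ioi]
        rfl
      -- Integrating x^{-1-1/q} over (y, 1) gives at most q y^{-1/q}, which cancels the weight in T.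
      rw [e, lintegral_mul_const _ (hm _)]
      refine (mul_le_mul_left (lintegral_Ioo_one_rpow_le hy.1 hy.2.le
        (by positivity : 0 < 1 / q)) _).trans (le_of_eq ?_)
      simp only [hT]
      rw [mul_comm (G y ^ p), ← mul_assoc, ← ENNReal.ofReal_mul (by positivity)]
      congr 2
      rw [div_mul_eq_mul_div, ← Real.rpow_add hy.1]
      simp
  calc ∫⁻ x in Ioo 0 1, ENNReal.ofReal (x ^ (-p)) * (∫⁻ y in Ioo 0 x, G y) ^ p
      ≤ ∫⁻ x in Ioo 0 1, ENNReal.ofReal (q ^ (p - 1)) * ∫⁻ y in Ioo 0 1, K x y := by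
        refine setLIntegral_mono' measurableSet_Ioo fun x hx => ?_
        rw [← inner x hx]
        exact rpow_mul_lintegral_rpow_le hpq hx.1
          (hG.mono_measure (volIoo_le_of_subset (Ioo_subset_Ioo_right hx.2.le)))
    _ = ENNReal.ofReal (q ^ (p - 1)) * ∫⁻ y in Ioo 0 1, ∫⁻ x in Ioo 0 1, K x y := by
        rw [lintegral_const_mul' _ _ ENNReal.ofReal_ne_top, lintegral_lintegral_swap hKm]
    _ ≤ ENNReal.ofReal (q ^ (p - 1)) * ∫⁻ y in Ioo 0 1, ENNReal.ofReal q * G y ^ p := by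
        exact mul_le_mul_right (setLIntegral_mono' measurableSet_Ioo outer) _
    _ = _ := by
        rw [lintegral_const_mul' _ _ ENNReal.ofReal_ne_top, ← mul_assoc,
          ← ENNReal.ofReal_mul (by positivity), ← Real.rpow_add_one hq.ne', sub_add_cancel]

/-- For finite p the constant is the conjugate exponent p/(p-1); for p = ∞ an average is bounded by
the supremum. -/
theorem exists_hardy_const {p : ℝ≥0∞} (hp : 1 < p) :
    ∃ H : ℝ≥0, ∀ g : ℝ → ℝ, MemLp g p (volIoo 0 1) →
      eLpNorm (fun x => x⁻¹ * ∫ t in (0 : ℝ)..x, g t) p (volIoo 0 1) ≤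
        H * eLpNorm g p (volIoo 0 1) := by
  rcases eq_or_ne p ⊤ with rfl | hpt
  · refine ⟨1, fun g hg => ?_⟩
    have hb : ∀ᵐ x ∂(volIoo 0 1), ‖x⁻¹ * ∫ t in (0 : ℝ)..x, g t‖
        ≤ (eLpNorm g ⊤ (volIoo 0 1)).toReal := by
      filter_upwards [ae_restrict_mem measurableSet_Ioo] with x hx
      have hμ : volIoo 0 x ≤ volIoo 0 1 := volIoo_le_of_subset (Ioo_subset_Ioo_right hx.2.le)
      have h1 := integral_abs_le_eLpNorm_mul_rpow le_top hx.1.le (hg.mono_measure hμ)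
      have h2 : (eLpNorm g ⊤ (volIoo 0 x)).toReal ≤ (eLpNorm g ⊤ (volIoo 0 1)).toReal :=
        ENNReal.toReal_mono hg.2.ne (eLpNorm_mono_measure g hμ)
      have h3 : ‖∫ t in (0 : ℝ)..x, g t‖ ≤ ∫ t in (0 : ℝ)..x, |g t| :=
        intervalIntegral.norm_integral_le_integral_norm hx.1.le
      simp only [ENNReal.toReal_top, div_zero, sub_zero, Real.rpow_one] at h1
      rw [norm_mul, norm_inv, Real.norm_of_nonneg hx.1.le, inv_mul_le_iff₀ hx.1, mul_comm x]
      exact h3.trans (h1.trans (mul_le_mul_of_nonneg_right h2 hx.1.le))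
    rw [ENNReal.coe_one, one_mul, eLpNorm_exponent_top]
    refine (eLpNormEssSup_le_of_ae_bound hb).trans ?_
    rw [ENNReal.ofReal_toReal hg.2.ne, eLpNorm_exponent_top]
  · have hp0 : p ≠ 0 := (zero_lt_one.trans hp).ne'
    have hp1 : 1 < p.toReal := by
      rw [← ENNReal.toReal_one]; exact (ENNReal.toReal_lt_toReal ENNReal.one_ne_top hpt).2 hp
    have hpq := Real.HolderConjugate.conjExponent hp1
    set P := p.toReal with hP
    set q := P.conjExponent with hq
    have hP0 : 0 < P := hpq.pos
    have hq0 : 0 < q := hpq.symm.pos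
    refine ⟨q.toNNReal, fun g hg => ?_⟩
    have h := lintegral_hardy_le hpq hg.1.enorm
    rw [eLpNorm_eq_lintegral_rpow_enorm_toReal hp0 hpt,
      eLpNorm_eq_lintegral_rpow_enorm_toReal hp0 hpt, ← hP]
    have h2 : ∫⁻ x in Ioo 0 1, ‖x⁻¹ * ∫ t in (0 : ℝ)..x, g t‖ₑ ^ P ≤
        ENNReal.ofReal (q ^ P) * ∫⁻ y in Ioo 0 1, ‖g y‖ₑ ^ P := by
      refine le_trans (setLIntegral_mono' measurableSet_Ioo fun x hx => ?_) h
      have hx0 := hx.1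
      rw [enorm_mul, ENNReal.mul_rpow_of_nonneg _ _ hP0.le,
        Real.enorm_of_nonneg (by positivity : 0 ≤ x⁻¹),
        ENNReal.ofReal_rpow_of_nonneg (by positivity) hP0.le, Real.inv_rpow hx.1.le,
        ← Real.rpow_neg hx.1.le]
      gcongr
      rw [intervalIntegral.integral_of_le hx.1.le, integral_Ioc_eq_integral_Ioo]
      exact enorm_integral_le_lintegral_enorm _
    calc _ ≤ (ENNReal.ofReal (q ^ P) * ∫⁻ y in Ioo 0 1, ‖g y‖ₑ ^ P) ^ (1 / P) := by gcongr
      _ = _ := by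
        rw [ENNReal.mul_rpow_of_nonneg _ _ (by positivity), ← ENNReal.ofReal_rpow_of_nonneg hq0.le hP0.le,
          ← ENNReal.rpow_mul, mul_one_div_cancel hP0.ne', ENNReal.rpow_one]
        rfl

/-! ### Estimates read off from the flux -/

theorem IsWeakDeriv.congr_ae_right {a b : ℝ} {u v v' : ℝ → ℝ} (h : IsWeakDeriv a b u v)
    (hv : v =ᵐ[volIoo a b] v') : IsWeakDeriv a b u v' where
  locallyIntegrable := h.locallyIntegrable
  locallyIntegrable_deriv := h.locallyIntegrable_deriv.congr_ae_restrict hv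
  integral_eq φ hφ hφc hφs := by
    rw [h.integral_eq φ hφ hφc hφs]
    congr 1
    refine integral_congr_ae ?_
    filter_upwards [hv] with x hx
    rw [hx]

theorem memLp_of_continuousOn_Icc {a b : ℝ} {h : ℝ → ℝ} (hh : ContinuousOn h (Icc a b))
    (p : ℝ≥0∞) : MemLp h p (volIoo a b) := by
  obtain ⟨C, hC⟩ := isCompact_Icc.exists_bound_of_continuousOn hh
  refine MemLp.of_bound ((hh.mono Ioo_subset_Icc_self).aestronglyMeasurable measurableSet_Ioo) C ?_
  filter_upwards [ae_restrict_mem measurableSet_Ioo] with x hx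
  exact hC x (Ioo_subset_Icc_self hx)

theorem memLp_continuousOn_Icc_mul {a b : ℝ} {g h : ℝ → ℝ} {p : ℝ≥0∞}
    (hh : ContinuousOn h (Icc a b)) (hg : MemLp g p (volIoo a b)) :
    MemLp (fun x => h x * g x) p (volIoo a b) := by
  obtain ⟨C, hC⟩ := isCompact_Icc.exists_bound_of_continuousOn hh
  refine hg.of_le_mul (c := C)
    (((hh.mono Ioo_subset_Icc_self).aestronglyMeasurable measurableSet_Ioo).mul hg.1) ?_
  filter_upwards [ae_restrict_mem measurableSet_Ioo] with x hx
  rw [norm_mul]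
  exact mul_le_mul_of_nonneg_right (hC x (Ioo_subset_Icc_self hx)) (norm_nonneg _)

theorem eLpNorm_volIoo_zero_one_le {h : ℝ → ℝ} {c : ℝ} (hc : ∀ x ∈ Ioo (0 : ℝ) 1, |h x| ≤ c)
    (p : ℝ≥0∞) : eLpNorm h p (volIoo 0 1) ≤ ENNReal.ofReal c := by
  refine (eLpNorm_le_of_ae_bound (C := c) ?_).trans (by simp)
  filter_upwards [ae_restrict_mem measurableSet_Ioo] with x hx using hc x hx

theorem continuousOn_rpow_const_Ioi (s : ℝ) : ContinuousOn (fun x : ℝ => x ^ s) (Ioi 0) :=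
  fun x hx => (Real.continuousAt_rpow_const x s (Or.inl (ne_of_gt hx))).continuousWithinAt

/-- `w` is the flux `x^{2α} u'` of `u`; it is locally absolutely continuous on `(0, 1)` with
derivative `g`, and vanishes at the origin. -/
structure IsFlux (α : ℝ) (g u w : ℝ → ℝ) : Prop where
  hasDerivAt : ∀ x, 0 < x → HasDerivAt u (x ^ (-(2 * α)) * w x) x
  continuousOn_flux : ContinuousOn w (Ioi 0)
  isLocPrimitive : IsLocPrimitive 0 1 w g
  tendsto_zero : Tendsto w (𝓝[>] 0) (𝓝 0)

namespace IsFlux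

variable {α : ℝ} {p : ℝ≥0∞} {g u w : ℝ → ℝ}

theorem deriv_eq (h : IsFlux α g u w) {x : ℝ} (hx : 0 < x) :
    deriv u x = x ^ (-(2 * α)) * w x := (h.hasDerivAt x hx).deriv

theorem rpow_mul_deriv (h : IsFlux α g u w) (s : ℝ) {x : ℝ} (hx : 0 < x) :
    x ^ (2 * α + s) * deriv u x = x ^ s * w x := by
  rw [h.deriv_eq hx, ← mul_assoc, ← Real.rpow_add hx]
  congr 2; ring

theorem flux_eq (h : IsFlux α g u w) {x : ℝ} (hx : 0 < x) :
    x ^ (2 * α) * deriv u x = w x := by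
  simpa using h.rpow_mul_deriv 0 hx

theorem continuousOn (h : IsFlux α g u w) : ContinuousOn u (Ioi 0) := fun x hx =>
  (h.hasDerivAt x hx).continuousAt.continuousWithinAt

theorem continuousOn_deriv (h : IsFlux α g u w) : ContinuousOn (deriv u) (Ioi 0) :=
  ((continuousOn_rpow_const_Ioi _).mul h.continuousOn_flux).congr fun _ hx => h.deriv_eq hx

theorem contDiffOn (h : IsFlux α g u w) : ContDiffOn ℝ 1 u (Ioc 0 1) := by
  have : ContDiffOn ℝ 1 u (Ioi 0) := by
    rw [show (1 : WithTop ℕ∞) = 0 + 1 from rfl, contDiffOn_succ_iff_deriv_of_isOpen isOpen_Ioi]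
    exact ⟨fun x hx => (h.hasDerivAt x hx).differentiableAt.differentiableWithinAt, by simp,
      contDiffOn_zero.2 h.continuousOn_deriv⟩
  exact this.mono Ioc_subset_Ioi_self

/-- On (c, x) this is the fundamental theorem of calculus; letting c → 0 uses both the vanishing of
w at 0 and integrability of g up to 0. -/
theorem eq_integral (h : IsFlux α g u w) (hg : IntegrableOn g (Ioo 0 1)) {x : ℝ}
    (hx : x ∈ Ioo (0 : ℝ) 1) : w x = ∫ t in (0 : ℝ)..x, g t := by
  have hgx : IntervalIntegrable g volume 0 1 :=
    (intervalIntegrable_iff_integrableOn_Ioo_of_le zero_le_one).2 hg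
  have hsub : ∀ {y z : ℝ}, y ∈ Icc (0 : ℝ) 1 → z ∈ Icc (0 : ℝ) 1 →
      IntervalIntegrable g volume y z := fun hy hz => hgx.mono_set (by
    rw [uIcc_of_le (zero_le_one' ℝ)]; exact ordConnected_Icc.uIcc_subset hy hz)
  have hcont : ContinuousOn (fun c => ∫ t in (0 : ℝ)..c, g t) (Icc 0 1) := by
    have := intervalIntegral.continuousOn_primitive_interval' hgx left_mem_uIcc
    rwa [uIcc_of_le (zero_le_one' ℝ)] at this
  have t1 : Tendsto (fun c => ∫ t in (0 : ℝ)..c, g t) (𝓝[>] 0) (𝓝 0) := by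
    have := (hcont 0 (by simp)).tendsto
    rw [intervalIntegral.integral_same] at this
    refine this.mono_left ?_
    rw [← nhdsWithin_Ioo_eq_nhdsGT (zero_lt_one' ℝ)]
    exact nhdsWithin_mono _ Ioo_subset_Icc_self
  have e : ∀ᶠ c in 𝓝[>] (0 : ℝ), w x - w c = (∫ t in (0 : ℝ)..x, g t) - ∫ t in (0 : ℝ)..c, g t := by
    filter_upwards [Ioo_mem_nhdsGT one_pos] with c hc
    have h0 : (0 : ℝ) ∈ Icc (0 : ℝ) 1 := by simp
    rw [intervalIntegral.integral_interval_sub_left (hsub h0 (Ioo_subset_Icc_self hx))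
      (hsub h0 (Ioo_subset_Icc_self hc)), h.isLocPrimitive.integral_eq_sub hc hx]
  have t2 : Tendsto (fun c => w x - w c) (𝓝[>] 0) (𝓝 (w x - 0)) := h.tendsto_zero.const_sub _
  have t3 := (t1.const_sub (∫ t in (0 : ℝ)..x, g t)).congr' (e.mono fun _ => Eq.symm)
  simpa using tendsto_nhds_unique t2 t3

/-- The norm is kept on (0, x) rather than (0, 1): its decay as x → 0 upgrades O to o when p < ∞. -/
theorem abs_le_mul_rpow (h : IsFlux α g u w) (hp : 1 ≤ p) (hg : MemLp g p (volIoo 0 1)) {x : ℝ}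
    (hx : x ∈ Ioo (0 : ℝ) 1) :
    |w x| ≤ (eLpNorm g p (volIoo 0 x)).toReal * x ^ (1 - 1 / p.toReal) := by
  rw [h.eq_integral (hg.integrableOn_Ioo hp) hx]
  exact (intervalIntegral.norm_integral_le_integral_norm (f := g) hx.1.le).trans
    (integral_abs_le_eLpNorm_mul_rpow hp hx.1.le
      (hg.mono_measure (volIoo_le_of_subset (Ioo_subset_Ioo_right hx.2.le))))

theorem abs_le (h : IsFlux α g u w) (hp : 1 ≤ p) (hg : MemLp g p (volIoo 0 1)) {x : ℝ}
    (hx : x ∈ Ioo (0 : ℝ) 1) : |w x| ≤ (eLpNorm g p (volIoo 0 1)).toReal := by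
  refine (h.abs_le_mul_rpow hp hg hx).trans ?_
  have h1 : (eLpNorm g p (volIoo 0 x)).toReal ≤ (eLpNorm g p (volIoo 0 1)).toReal :=
    ENNReal.toReal_mono hg.2.ne
      (eLpNorm_mono_measure g (volIoo_le_of_subset (Ioo_subset_Ioo_right hx.2.le)))
  have h2 : x ^ (1 - 1 / p.toReal) ≤ 1 := by
    refine Real.rpow_le_one hx.1.le hx.2.le ?_
    rcases eq_or_ne p ⊤ with rfl | hpt
    · simp
    · have : 1 ≤ p.toReal := by simpa using ENNReal.toReal_mono hpt hp
      rw [sub_nonneg, div_le_one (by linarith)]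
      exact this
  calc _ ≤ (eLpNorm g p (volIoo 0 1)).toReal * 1 :=
        mul_le_mul h1 h2 (Real.rpow_nonneg hx.1.le _) ENNReal.toReal_nonneg
    _ = _ := mul_one _

theorem flux_ae_eq (h : IsFlux α g u w) :
    w =ᵐ[volIoo 0 1] fun x => x ^ (2 * α) * deriv u x := by
  filter_upwards [ae_restrict_mem measurableSet_Ioo] with x hx using (h.flux_eq hx.1).symm

theorem isWeakDeriv_flux (h : IsFlux α g u w) :
    IsWeakDeriv 0 1 (fun x => x ^ (2 * α) * deriv u x) g :=
  h.isLocPrimitive.isWeakDeriv.congr_ae_left h.flux_ae_eq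

theorem isLocPrimitive_deriv (h : IsFlux α g u w) :
    IsLocPrimitive 0 1 (fun x => x ^ (-(2 * α)) * w x)
      (fun x => -(2 * α) * x ^ (-(2 * α) - 1) * w x + x ^ (-(2 * α)) * g x) := by
  refine IsLocPrimitive.mul (.of_hasDerivAt (fun x hx =>
    Real.hasDerivAt_rpow_const (Or.inl hx.1.ne')) ?_) h.isLocPrimitive
  exact (continuousOn_const.mul (continuousOn_rpow_const_Ioi _)).mono Ioo_subset_Ioi_self

/-- Allowing ε = 0 lets the same formula serve W^{2,p}_loc and the weak u'' on all of (0, 1). -/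
theorem isWeakDeriv_deriv (h : IsFlux α g u w) {ε : ℝ} (hε : 0 ≤ ε) :
    IsWeakDeriv ε 1 (deriv u)
      (fun x => -(2 * α) * x ^ (-(2 * α) - 1) * w x + x ^ (-(2 * α)) * g x) := by
  refine (h.isLocPrimitive_deriv.mono (Ioo_subset_Ioo_left hε)).isWeakDeriv.congr_ae_left ?_
  filter_upwards [ae_restrict_mem measurableSet_Ioo] with x hx
    using (h.deriv_eq (hε.trans_lt hx.1)).symm

theorem isWeakDeriv (h : IsFlux α g u w) {ε : ℝ} (hε : 0 ≤ ε) : IsWeakDeriv ε 1 u (deriv u) := by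
  have hsub : Ioo ε 1 ⊆ Ioi 0 := fun x hx => hε.trans_lt hx.1
  refine (IsLocPrimitive.of_hasDerivAt (fun x hx => ?_) (h.continuousOn_deriv.mono hsub)).isWeakDeriv
  exact (h.hasDerivAt x (hsub hx)).differentiableAt.hasDerivAt

theorem memW2pLoc (h : IsFlux α g u w) (hg : MemLp g p (volIoo 0 1)) : MemW2pLoc p u := by
  intro ε hε _
  have hsub : Icc ε 1 ⊆ Ioi 0 := fun x hx => hε.trans_le hx.1
  have h1 := h.isWeakDeriv hε.le
  have hgε : MemLp g p (volIoo ε 1) :=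
    hg.mono_measure (volIoo_le_of_subset (Ioo_subset_Ioo_left hε.le))
  refine ⟨h1.weaklyDifferentiable, memLp_of_continuousOn_Icc (h.continuousOn.mono hsub) p, ?_⟩
  refine ((h.isWeakDeriv_deriv hε.le).congr_ae_left h1.weakDeriv_ae_eq.symm).memW1p ?_ ?_
  · exact (memLp_congr_ae h1.weakDeriv_ae_eq).2
      (memLp_of_continuousOn_Icc (h.continuousOn_deriv.mono hsub) p)
  · refine (memLp_of_continuousOn_Icc ?_ p).add
      (memLp_continuousOn_Icc_mul ((continuousOn_rpow_const_Ioi _).mono hsub) hgε)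
    exact ((continuousOn_const.mul (continuousOn_rpow_const_Ioi _)).mul h.continuousOn_flux).mono hsub

theorem isNeumannSolution {f : ℝ → ℝ} (h : IsFlux α (fun x => u x - f x) u w)
    (hg : MemLp (fun x => u x - f x) p (volIoo 0 1)) (hu1 : u 1 = 0) :
    IsNeumannSolution α p f u where
  memW2pLoc := h.memW2pLoc hg
  contDiffOn := h.contDiffOn
  weaklyDifferentiable := h.isWeakDeriv_flux.weaklyDifferentiable
  equation := by
    filter_upwards [h.isWeakDeriv_flux.weakDeriv_ae_eq] with x hx
    rw [hx]; ring
  dirichlet_one := hu1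
  neumann_zero := by
    refine h.tendsto_zero.congr' ?_
    filter_upwards [self_mem_nhdsWithin] with x hx using (h.flux_eq hx).symm

/-- The powers of x cancel against the Hölder bound and leave the L^p norm of g on (0, x), which
tends to 0 by absolute continuity of the integral. -/
theorem tendsto_rpow_mul_deriv (h : IsFlux α g u w) (hp : 1 ≤ p) (hpt : p ≠ ⊤)
    (hg : MemLp g p (volIoo 0 1)) :
    Tendsto (fun x : ℝ => x ^ (2 * α - 1 + 1 / p.toReal) * deriv u x) (𝓝[>] 0) (𝓝 0) := by
  have hp0 : p ≠ 0 := (zero_lt_one.trans_le hp).ne'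
  have hP : 0 < p.toReal := ENNReal.toReal_pos hp0 hpt
  have lim : Tendsto (fun x => eLpNorm g p (volIoo 0 x)) (𝓝[>] 0) (𝓝 0) := by
    have hfin : ∫⁻ x in Ioo 0 1, ‖g x‖ₑ ^ p.toReal ≠ ⊤ :=
      (lintegral_rpow_enorm_lt_top_of_eLpNorm_lt_top hp0 hpt hg.2).ne
    have hs : Tendsto (fun x => volIoo 0 1 (Ioo 0 x)) (𝓝[>] 0) (𝓝 0) := by
      have h1 : Tendsto (fun x : ℝ => ENNReal.ofReal x) (𝓝[>] 0) (𝓝 0) := by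
        have := ENNReal.continuous_ofReal.tendsto 0
        rw [ENNReal.ofReal_zero] at this
        exact this.mono_left nhdsWithin_le_nhds
      refine tendsto_of_tendsto_of_tendsto_of_le_of_le tendsto_const_nhds h1
        (fun _ => zero_le) fun x => ?_
      refine (Measure.restrict_apply_le _ _).trans ?_
      simp
    have h2 := tendsto_setLIntegral_zero hfin hs
    have h3 := (ENNReal.continuous_rpow_const (y := 1 / p.toReal)).tendsto 0 |>.comp h2
    rw [ENNReal.zero_rpow_of_pos (by positivity)] at h3
    refine h3.congr' ?_
    filter_upwards [Ioo_mem_nhdsGT one_pos] with x hx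
    rw [eLpNorm_eq_lintegral_rpow_enorm_toReal hp0 hpt, Function.comp_apply,
      Measure.restrict_restrict measurableSet_Ioo,
      inter_eq_left.2 (Ioo_subset_Ioo_right hx.2.le)]
  have lim' := (ENNReal.tendsto_toReal ENNReal.zero_ne_top).comp lim
  rw [ENNReal.toReal_zero] at lim'
  refine squeeze_zero_norm' ?_ lim'
  filter_upwards [Ioo_mem_nhdsGT one_pos] with x hx
  have h1 := h.abs_le_mul_rpow hp hg hx
  have h2 := h.rpow_mul_deriv (-1 + 1 / p.toReal) hx.1
  have hx0 := hx.1
  rw [show 2 * α - 1 + 1 / p.toReal = 2 * α + (-1 + 1 / p.toReal) by ring, h2, norm_mul,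
    Real.norm_of_nonneg (by positivity), Real.norm_eq_abs]
  calc x ^ (-1 + 1 / p.toReal) * |w x|
      ≤ x ^ (-1 + 1 / p.toReal) *
        ((eLpNorm g p (volIoo 0 x)).toReal * x ^ (1 - 1 / p.toReal)) := by gcongr
    _ = (eLpNorm g p (volIoo 0 x)).toReal * (x ^ (-1 + 1 / p.toReal) * x ^ (1 - 1 / p.toReal)) := by
        ring
    _ = _ := by
        rw [← Real.rpow_add hx.1]; simp

theorem enorm_rpow_mul_deriv_le (h : IsFlux α g u w) (hg : MemLp g ⊤ (volIoo 0 1)) {x : ℝ}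
    (hx : x ∈ Ioo (0 : ℝ) 1) :
    ‖x ^ (2 * α - 1) * deriv u x‖ₑ ≤ eLpNorm g ⊤ (volIoo 0 1) := by
  have h1 := h.abs_le_mul_rpow le_top hg hx
  have hx0 := hx.1
  rw [ENNReal.toReal_top, div_zero, sub_zero, Real.rpow_one] at h1
  have hmono : eLpNorm g ⊤ (volIoo 0 x) ≤ eLpNorm g ⊤ (volIoo 0 1) :=
    eLpNorm_mono_measure g (volIoo_le_of_subset (Ioo_subset_Ioo_right hx.2.le))
  have hfin : eLpNorm g ⊤ (volIoo 0 x) ≠ ⊤ := (hmono.trans_lt hg.2).ne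
  refine le_trans ?_ hmono
  rw [sub_eq_add_neg, h.rpow_mul_deriv (-1) hx.1, ← ofReal_norm, norm_mul,
    Real.norm_of_nonneg (by positivity), Real.norm_eq_abs, Real.rpow_neg_one,
    ← ENNReal.ofReal_toReal hfin]
  refine ENNReal.ofReal_le_ofReal ?_
  rw [inv_mul_le_iff₀ hx.1]
  linarith

theorem memLp_flux (h : IsFlux α g u w) (hp : 1 ≤ p) (hg : MemLp g p (volIoo 0 1)) :
    MemLp w p (volIoo 0 1) := by
  refine MemLp.of_bound ((h.continuousOn_flux.mono Ioo_subset_Ioi_self).aestronglyMeasurable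
    measurableSet_Ioo) (eLpNorm g p (volIoo 0 1)).toReal ?_
  filter_upwards [ae_restrict_mem measurableSet_Ioo] with x hx using h.abs_le hp hg hx

theorem memW1p_flux (h : IsFlux α g u w) (hp : 1 ≤ p) (hg : MemLp g p (volIoo 0 1)) :
    MemW1p 0 1 p (fun x => x ^ (2 * α) * deriv u x) :=
  h.isWeakDeriv_flux.memW1p ((memLp_congr_ae h.flux_ae_eq).1 (h.memLp_flux hp hg)) hg

theorem w1pNorm_flux_le (h : IsFlux α g u w) (hp : 1 ≤ p) (hg : MemLp g p (volIoo 0 1)) :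
    w1pNorm 0 1 p (fun x => x ^ (2 * α) * deriv u x) ≤ 2 * eLpNorm g p (volIoo 0 1) := by
  rw [h.isWeakDeriv_flux.w1pNorm_eq, ← eLpNorm_congr_ae h.flux_ae_eq, two_mul]
  gcongr
  refine (eLpNorm_volIoo_zero_one_le (fun x hx => h.abs_le hp hg hx) p).trans ?_
  rw [ENNReal.ofReal_toReal hg.2.ne]

/-- Almost everywhere x^{2α-1} u' = w/x is the mean of g over (0, x), and x^{2α} u'' = g - 2α w/x.
Hardy's inequality enters as the assumption `hH`. -/
theorem weighted_bounds (h : IsFlux α g u w) (hp : 1 ≤ p) (hg : MemLp g p (volIoo 0 1)) {H : ℝ≥0}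
    (hH : eLpNorm (fun x => x⁻¹ * ∫ t in (0 : ℝ)..x, g t) p (volIoo 0 1) ≤
      H * eLpNorm g p (volIoo 0 1)) :
    MemLp (fun x => x ^ (2 * α - 1) * deriv u x) p (volIoo 0 1) ∧
    MemLp (fun x => x ^ (2 * α) * weakDeriv 0 1 (deriv u) x) p (volIoo 0 1) ∧
    eLpNorm (fun x => x ^ (2 * α - 1) * deriv u x) p (volIoo 0 1) +
        eLpNorm (fun x => x ^ (2 * α) * weakDeriv 0 1 (deriv u) x) p (volIoo 0 1) ≤
      (H + (‖2 * α‖₊ * H + 1) : ℝ≥0) * eLpNorm g p (volIoo 0 1) := by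
  set k : ℝ → ℝ := fun x => x ^ (2 * α - 1) * deriv u x with hk
  have e1 : k =ᵐ[volIoo 0 1] fun x => x⁻¹ * ∫ t in (0 : ℝ)..x, g t := by
    filter_upwards [ae_restrict_mem measurableSet_Ioo] with x hx
    rw [hk]
    simp only
    rw [sub_eq_add_neg, h.rpow_mul_deriv (-1) hx.1, Real.rpow_neg_one,
      h.eq_integral (hg.integrableOn_Ioo hp) hx]
  have hkn : eLpNorm k p (volIoo 0 1) ≤ H * eLpNorm g p (volIoo 0 1) := by
    rwa [eLpNorm_congr_ae e1]
  have hkm : MemLp k p (volIoo 0 1) := by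
    refine ⟨((((continuousOn_rpow_const_Ioi _).mul h.continuousOn_deriv).mono
      Ioo_subset_Ioi_self).aestronglyMeasurable measurableSet_Ioo), hkn.trans_lt ?_⟩
    exact ENNReal.mul_lt_top ENNReal.coe_lt_top hg.2
  have e2 : (fun x => x ^ (2 * α) * weakDeriv 0 1 (deriv u) x) =ᵐ[volIoo 0 1]
      (-(2 * α)) • k + g := by
    filter_upwards [(h.isWeakDeriv_deriv le_rfl).weakDeriv_ae_eq,
      ae_restrict_mem measurableSet_Ioo] with x hx hx1
    have e3 : x ^ (2 * α) * x ^ (-(2 * α)) = 1 := by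
      rw [← Real.rpow_add hx1.1]; simp
    have e4 : x ^ (2 * α) * x ^ (-(2 * α) - 1) = x ^ (-1 : ℝ) := by
      rw [← Real.rpow_add hx1.1]; congr 1; ring
    have e5 : k x = x ^ (-1 : ℝ) * w x := by
      rw [hk]; simp only
      rw [sub_eq_add_neg, h.rpow_mul_deriv (-1) hx1.1]
    simp only [hx, Pi.add_apply, Pi.smul_apply, smul_eq_mul, e5]
    rw [← e4]
    linear_combination g x * e3
  have hm2 : MemLp ((-(2 * α)) • k + g) p (volIoo 0 1) := (hkm.const_smul _).add hg
  refine ⟨hkm, (memLp_congr_ae e2).2 hm2, ?_⟩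
  rw [eLpNorm_congr_ae e2]
  calc _ ≤ H * eLpNorm g p (volIoo 0 1) +
        (‖2 * α‖₊ * (H * eLpNorm g p (volIoo 0 1)) + eLpNorm g p (volIoo 0 1)) := by
        refine add_le_add hkn ((eLpNorm_add_le (hkm.const_smul _).1 hg.1 hp).trans ?_)
        rw [eLpNorm_const_smul, enorm_neg]
        gcongr
        rfl
    _ = _ := by push_cast; ring

theorem memW1p_of_nonpos (h : IsFlux α g u w) (hp : 1 ≤ p) (hg : MemLp g p (volIoo 0 1))
    (hu : MemLp u p (volIoo 0 1)) (hα : α ≤ 0) :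
    MemW1p 0 1 p u ∧
      w1pNorm 0 1 p u ≤ eLpNorm u p (volIoo 0 1) + eLpNorm g p (volIoo 0 1) := by
  have hb : ∀ x ∈ Ioo (0 : ℝ) 1, |deriv u x| ≤ (eLpNorm g p (volIoo 0 1)).toReal := fun x hx => by
    have hx0 := hx.1
    rw [h.deriv_eq hx.1, abs_mul, abs_of_nonneg (by positivity)]
    have h1 : x ^ (-(2 * α)) ≤ 1 := Real.rpow_le_one hx.1.le hx.2.le (by linarith)
    exact (mul_le_of_le_one_left (abs_nonneg _) h1).trans (h.abs_le hp hg hx)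
  have hm : MemLp (deriv u) p (volIoo 0 1) := by
    refine MemLp.of_bound ((h.continuousOn_deriv.mono Ioo_subset_Ioi_self).aestronglyMeasurable
      measurableSet_Ioo) (eLpNorm g p (volIoo 0 1)).toReal ?_
    filter_upwards [ae_restrict_mem measurableSet_Ioo] with x hx using hb x hx
  refine ⟨(h.isWeakDeriv le_rfl).memW1p hu hm, ?_⟩
  rw [(h.isWeakDeriv le_rfl).w1pNorm_eq]
  gcongr
  refine (eLpNorm_volIoo_zero_one_le hb p).trans ?_
  rw [ENNReal.ofReal_toReal hg.2.ne]

/-- Since w is bounded, |u'| ≤ ‖g‖_p t^{-2α}, integrable at 0. Integration even gives the exponent 1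
- 2α, which on an interval of length 1 implies the weaker 1/2 - α. -/
theorem exists_holder_extension (h : IsFlux α g u w) (hp : 1 ≤ p) (hg : MemLp g p (volIoo 0 1))
    (hu1 : u 1 = 0) (hα0 : 0 < α) (hα : α < 1 / 2) :
    ∃ U : ℝ → ℝ, EqOn U u (Ioc 0 1) ∧
      MemHolder (1 / 2 - α).toNNReal ((Icc (0 : ℝ) 1).domRestrict U) ∧
      holderNorm01 (1 / 2 - α).toNNReal U ≤
        (2 * (1 - 2 * α)⁻¹.toNNReal : ℝ≥0) * eLpNorm g p (volIoo 0 1) := by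
  set G := (eLpNorm g p (volIoo 0 1)).toReal with hG
  set s := 1 - 2 * α with hs
  have hs0 : 0 < s := by linarith
  have hs1 : s ≤ 1 := by linarith
  set k : ℝ → ℝ := fun t => t ^ (-(2 * α)) * w t with hk
  have hpow : ∀ x y : ℝ, IntervalIntegrable (fun t : ℝ => G * t ^ (-(2 * α))) volume x y :=
    fun x y => (intervalIntegral.intervalIntegrable_rpow' (by linarith)).const_mul G
  have hkb : ∀ t ∈ Ioo (0 : ℝ) 1, ‖k t‖ ≤ G * t ^ (-(2 * α)) := fun t ht => by
    have ht0 := ht.1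
    rw [hk, norm_mul, Real.norm_of_nonneg (by positivity), mul_comm]
    gcongr
    exact h.abs_le hp hg ht
  have hki : IntervalIntegrable k volume 0 1 := by
    rw [intervalIntegrable_iff_integrableOn_Ioo_of_le zero_le_one]
    refine Integrable.mono' ((intervalIntegrable_iff_integrableOn_Ioo_of_le zero_le_one).1
      (hpow 0 1)) ((((continuousOn_rpow_const_Ioi _).mul h.continuousOn_flux).mono
        Ioo_subset_Ioi_self).aestronglyMeasurable measurableSet_Ioo) ?_
    filter_upwards [ae_restrict_mem measurableSet_Ioo] with t ht using hkb t ht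
  have hki' : ∀ {y z : ℝ}, y ∈ Icc (0 : ℝ) 1 → z ∈ Icc (0 : ℝ) 1 →
      IntervalIntegrable k volume y z := fun hy hz => hki.mono_set (by
    rw [uIcc_of_le (zero_le_one' ℝ)]; exact ordConnected_Icc.uIcc_subset hy hz)
  have h1mem : (1 : ℝ) ∈ Icc (0 : ℝ) 1 := by simp
  -- The integral converges at x = 0 as well, so this formula is the extension.
  set U : ℝ → ℝ := fun x => -∫ t in x..1, k t with hU
  have hUd : ∀ x ∈ Icc (0 : ℝ) 1, ∀ y ∈ Icc (0 : ℝ) 1, x ≤ y →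
      |U y - U x| ≤ G * s⁻¹ * (y - x) ^ (1 / 2 - α) := by
    intro x hx y hy hxy
    have e : U y - U x = ∫ t in x..y, k t := by
      have := intervalIntegral.integral_add_adjacent_intervals (hki' hx hy) (hki' hy h1mem)
      simp only [hU]
      linarith
    have hb : ‖∫ t in x..y, k t‖ ≤ ∫ t in x..y, G * t ^ (-(2 * α)) := by
      rw [intervalIntegral.integral_of_le hxy, intervalIntegral.integral_of_le hxy,
        integral_Ioc_eq_integral_Ioo, integral_Ioc_eq_integral_Ioo]
      refine norm_integral_le_of_norm_le
        ((intervalIntegrable_iff_integrableOn_Ioo_of_le hxy).1 (hpow x y)) ?_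
      filter_upwards [ae_restrict_mem measurableSet_Ioo] with t ht
      exact hkb t ⟨hx.1.trans_lt ht.1, ht.2.trans_le hy.2⟩
    rw [e]
    refine hb.trans ?_
    rw [intervalIntegral.integral_const_mul, integral_rpow (Or.inl (by linarith)),
      show -(2 * α) + 1 = s by rw [hs]; ring, mul_assoc, div_eq_inv_mul]
    have hxy0 : 0 ≤ y - x := by linarith
    -- Subadditivity of t^s for 0 < s ≤ 1.
    have h2 : y ^ s - x ^ s ≤ (y - x) ^ s := by
      have := Real.rpow_add_le_add_rpow hx.1 hxy0 hs0.le hs1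
      rw [add_sub_cancel] at this
      linarith
    have h3 : (y - x) ^ s ≤ (y - x) ^ (1 / 2 - α) :=
      Real.rpow_le_rpow_of_exponent_ge_of_imp hxy0 (by linarith [hx.1, hy.2]) (by linarith)
        fun _ h => by linarith
    have hG0 : 0 ≤ G := ENNReal.toReal_nonneg
    gcongr
    exact h2.trans h3
  have hUd' : ∀ x ∈ Icc (0 : ℝ) 1, ∀ y ∈ Icc (0 : ℝ) 1,
      |U x - U y| ≤ G * s⁻¹ * |x - y| ^ (1 / 2 - α) := by
    intro x hx y hy
    rcases le_total x y with hxy | hxy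
    · rw [abs_sub_comm, abs_sub_comm x, abs_of_nonneg (sub_nonneg.2 hxy)]
      exact hUd x hx y hy hxy
    · rw [abs_of_nonneg (sub_nonneg.2 hxy)]
      exact hUd y hy x hx hxy
  set C : ℝ≥0 := (eLpNorm g p (volIoo 0 1)).toNNReal * s⁻¹.toNNReal with hC
  have hCr : (C : ℝ) = G * s⁻¹ := by
    rw [hC, NNReal.coe_mul, Real.coe_toNNReal _ (by positivity)]; rfl
  have hCe : (C : ℝ≥0∞) = s⁻¹.toNNReal * eLpNorm g p (volIoo 0 1) := by
    rw [hC, ENNReal.coe_mul, ENNReal.coe_toNNReal hg.2.ne, mul_comm]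
  have hγ : (((1 / 2 - α).toNNReal : ℝ≥0) : ℝ) = 1 / 2 - α :=
    Real.coe_toNNReal _ (by linarith)
  have hH : HolderWith C (1 / 2 - α).toNNReal ((Icc (0 : ℝ) 1).domRestrict U) := by
    intro x y
    rw [edist_nndist, edist_nndist, ← ENNReal.coe_rpow_of_nonneg _ (NNReal.coe_nonneg _),
      ← ENNReal.coe_mul, ENNReal.coe_le_coe, ← NNReal.coe_le_coe]
    push_cast
    rw [hγ, hCr, Real.dist_eq, Subtype.dist_eq, Real.dist_eq]
    exact hUd' x x.2 y y.2
  refine ⟨U, fun x hx => ?_, hH.memHolder, ?_⟩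
  · have hsub : uIcc x 1 ⊆ Ioi 0 := ordConnected_Ioi.uIcc_subset hx.1 (mem_Ioi.2 one_pos)
    have := intervalIntegral.integral_eq_sub_of_hasDerivAt (f := u) (f' := k) (a := x) (b := 1)
      (fun t ht => h.hasDerivAt t (hsub ht))
      (hki' (Ioc_subset_Icc_self hx) h1mem)
    simp only [hU]
    rw [this, hu1]
    ring
  · rw [holderNorm01]
    -- Comparing with U(1) = 0, the Hölder constant also bounds the supremum; hence the factor 2 in
    -- the estimate.
    have b1 : (⨆ x ∈ Icc (0 : ℝ) 1, ‖U x‖ₑ) ≤ C := by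
      refine iSup₂_le fun x hx => ?_
      have h1 := hUd' x hx 1 h1mem
      have h2 : U 1 = 0 := by simp [hU]
      rw [h2, sub_zero] at h1
      have h3 : |x - 1| ^ (1 / 2 - α) ≤ 1 := Real.rpow_le_one (abs_nonneg _)
        (by rw [_root_.abs_le]; constructor <;> linarith [hx.1, hx.2]) (by linarith)
      rw [← ofReal_norm, Real.norm_eq_abs, ← ENNReal.ofReal_coe_nnreal]
      refine ENNReal.ofReal_le_ofReal (h1.trans ?_)
      rw [← hCr]
      exact mul_le_of_le_one_right C.2 h3
    refine (add_le_add b1 hH.eHolderNorm_le).trans (le_of_eq ?_)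
    rw [hCe]
    push_cast
    ring

end IsFlux

/-! ### Uniqueness by an energy argument -/

theorem IsNeumannSolution.isWeakDeriv_flux {α : ℝ} {p : ℝ≥0∞} {f u : ℝ → ℝ}
    (h : IsNeumannSolution α p f u) :
    IsWeakDeriv 0 1 (fun x => x ^ (2 * α) * deriv u x) (fun x => u x - f x) := by
  refine h.weaklyDifferentiable.isWeakDeriv.congr_ae_right ?_
  filter_upwards [h.equation] with x hx
  linarith

theorem IsNeumannSolution.hasDerivAt {α : ℝ} {p : ℝ≥0∞} {f u : ℝ → ℝ}
    (h : IsNeumannSolution α p f u) {x : ℝ} (hx : x ∈ Ioo (0 : ℝ) 1) :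
    HasDerivAt u (deriv u x) x :=
  ((h.contDiffOn.contDiffAt (Ioc_mem_nhds hx.1 hx.2)).differentiableAt (by simp)).hasDerivAt

/-- `deriv u` at the right endpoint depends on u beyond it, so continuity up to b is obtained from
the one-sided derivative. -/
theorem ContDiffOn.exists_continuousOn_eq_deriv_Ioo {u : ℝ → ℝ} {a b : ℝ}
    (hu : ContDiffOn ℝ 1 u (Ioc a b)) :
    ∃ k : ℝ → ℝ, ContinuousOn k (Ioc a b) ∧ EqOn k (deriv u) (Ioo a b) := by
  refine ⟨derivWithin u (Ioc a b), hu.continuousOn_derivWithin (uniqueDiffOn_Ioc a b) le_rfl,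
    fun x hx => derivWithin_of_mem_nhds (Ioc_mem_nhds hx.1 hx.2)⟩

/-- The difference of two Neumann solutions is squeezed to zero by the energy identity
`(d w)' = x^{-2α} w² + d²` for its flux `w`, which makes `w²` nonincreasing. -/
theorem IsNeumannSolution.eqOn {α : ℝ} {p : ℝ≥0∞} {f u v : ℝ → ℝ}
    (hv : IsNeumannSolution α p f v) (hu : IsNeumannSolution α p f u) : EqOn v u (Ioc 0 1) := by
  obtain ⟨ku, huc, hue⟩ := hu.contDiffOn.exists_continuousOn_eq_deriv_Ioo
  obtain ⟨kv, hvc, hve⟩ := hv.contDiffOn.exists_continuousOn_eq_deriv_Ioo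
  set d : ℝ → ℝ := fun x => v x - u x with hd
  set w : ℝ → ℝ := fun x => x ^ (2 * α) * (kv x - ku x) with hw
  have hdc : ContinuousOn d (Ioc 0 1) := hv.contDiffOn.continuousOn.sub hu.contDiffOn.continuousOn
  have hwc : ContinuousOn w (Ioc 0 1) :=
    ((continuousOn_rpow_const_Ioi _).mono Ioc_subset_Ioi_self).mul (hvc.sub huc)
  have hwe : ∀ x ∈ Ioo (0 : ℝ) 1,
      x ^ (2 * α) * deriv v x - x ^ (2 * α) * deriv u x = w x := fun x hx => by
    simp only [hw, hve hx, hue hx]; ring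
  have hweak : IsWeakDeriv 0 1 w d := by
    refine ((hv.isWeakDeriv_flux.sub hu.isWeakDeriv_flux).congr_ae_left ?_).congr_ae_right
      (.of_forall fun x => ?_)
    · filter_upwards [ae_restrict_mem measurableSet_Ioo] with x hx using hwe x hx
    · simp [hd]
  have hwd : ∀ x ∈ Ioo (0 : ℝ) 1, HasDerivAt w (d x) x := fun x hx =>
    hweak.hasDerivAt (hwc.mono Ioo_subset_Ioc_self) (hdc.mono Ioo_subset_Ioc_self) hx
  have hdd : ∀ x ∈ Ioo (0 : ℝ) 1, HasDerivAt d (x ^ (-(2 * α)) * w x) x := fun x hx => by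
    refine ((hv.hasDerivAt hx).sub (hu.hasDerivAt hx)).congr_deriv ?_
    simp only [hw]
    rw [← mul_assoc, ← Real.rpow_add hx.1, hve hx, hue hx]
    simp
  have hw0 : Tendsto w (𝓝[>] 0) (𝓝 0) := by
    have := hv.neumann_zero.sub hu.neumann_zero
    rw [sub_zero] at this
    refine this.congr' ?_
    filter_upwards [Ioo_mem_nhdsGT one_pos] with x hx using hwe x hx
  have hd1 : d 1 = 0 := by simp [hd, hv.dirichlet_one, hu.dirichlet_one]
  -- Monotonicity together with d(1) = 0 determines the sign of d w, so no control of d near 0 is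
  -- needed.
  have henergy : MonotoneOn (fun x => d x * w x) (Ioc 0 1) := by
    refine monotoneOn_of_hasDerivWithinAt_nonneg (convex_Ioc 0 1) (hdc.mul hwc)
      (f' := fun x => x ^ (-(2 * α)) * w x * w x + d x * d x) (fun x hx => ?_) (fun x hx => ?_)
    · rw [interior_Ioc] at hx ⊢
      exact ((hdd x hx).mul (hwd x hx)).hasDerivWithinAt
    · rw [interior_Ioc] at hx
      have := hx.1
      rw [mul_assoc]
      exact add_nonneg (mul_nonneg (by positivity) (mul_self_nonneg _)) (mul_self_nonneg _)
  have hneg : ∀ x ∈ Ioc (0 : ℝ) 1, d x * w x ≤ 0 := fun x hx => by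
    have := henergy hx (right_mem_Ioc.2 one_pos) hx.2
    simpa [hd1] using this
  have hanti : AntitoneOn (fun x => w x * w x) (Ioc 0 1) := by
    refine antitoneOn_of_hasDerivWithinAt_nonpos (convex_Ioc 0 1) (hwc.mul hwc)
      (f' := fun x => d x * w x + w x * d x) (fun x hx => ?_) (fun x hx => ?_)
    · rw [interior_Ioc] at hx ⊢
      exact ((hwd x hx).mul (hwd x hx)).hasDerivWithinAt
    · rw [interior_Ioc] at hx
      linarith [hneg x (Ioo_subset_Ioc_self hx), mul_comm (d x) (w x)]
  have hwz : ∀ x ∈ Ioc (0 : ℝ) 1, w x = 0 := fun x hx => by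
    have hlim : Tendsto (fun y => w y * w y) (𝓝[>] 0) (𝓝 0) := by simpa using hw0.mul hw0
    have : w x * w x ≤ 0 := by
      refine ge_of_tendsto hlim ?_
      filter_upwards [Ioo_mem_nhdsGT hx.1] with y hy
      exact hanti ⟨hy.1, hy.2.le.trans hx.2⟩ hx hy.2.le
    exact mul_self_eq_zero.1 (le_antisymm this (mul_self_nonneg _))
  intro x hx
  rcases hx.2.eq_or_lt with rfl | hx1
  · exact sub_eq_zero.1 hd1
  · have h0 : HasDerivAt w 0 x := (hasDerivAt_const x (0 : ℝ)).congr_of_eventuallyEq (by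
      filter_upwards [Ioc_mem_nhds hx.1 hx1] with y hy using hwz y hy)
    exact sub_eq_zero.1 ((hwd x ⟨hx.1, hx1⟩).unique h0)

/-! ### The L^p bound and the theorem -/

theorem exists_isFlux_of_memLp {α : ℝ} (hα : α < 1) {p : ℝ≥0∞} (hp : 1 ≤ p) :
    ∃ C : ℝ≥0, ∀ f : ℝ → ℝ, MemLp f p (volIoo 0 1) → ∃ u w : ℝ → ℝ,
      IsFlux α (fun x => u x - f x) u w ∧ u 1 = 0 ∧ MemLp u p (volIoo 0 1) ∧
      eLpNorm u p (volIoo 0 1) ≤ C * eLpNorm f p (volIoo 0 1) := by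
  obtain ⟨M, hM0, hM⟩ := exists_regular_solution hα
  obtain ⟨κ, hκ, hκb⟩ := exists_memLp_majorant_rpow_tail (by linarith : 0 < 2 - 2 * α) hp
  refine ⟨M.toNNReal * (eLpNorm κ p (volIoo 0 1)).toNNReal, fun f hf => ?_⟩
  obtain ⟨u, w, h1, h2, h3, h4, h5, h6⟩ := hM f (hf.integrableOn_Ioo hp)
  have hflux : IsFlux α (fun x => u x - f x) u w := ⟨h1, h2, h3, h4⟩
  set N := (eLpNorm f p (volIoo 0 1)).toReal with hN
  -- Hölder on (0, t) supplies the growth hypothesis with r = 1/p.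
  have hb := h6 (1 / p.toReal) N fun t ht => by
    have hμ : volIoo 0 t ≤ volIoo 0 1 := volIoo_le_of_subset (Ioo_subset_Ioo_right ht.2)
    refine (integral_abs_le_eLpNorm_mul_rpow hp ht.1.le (hf.mono_measure hμ)).trans ?_
    exact mul_le_mul_of_nonneg_right
      (ENNReal.toReal_mono hf.2.ne (eLpNorm_mono_measure f hμ)) (Real.rpow_nonneg ht.1.le _)
  have hMN : 0 ≤ M * N := mul_nonneg hM0 ENNReal.toReal_nonneg
  have hbound : ∀ᵐ x ∂(volIoo 0 1), ‖u x‖ ≤ M * N * ‖κ x‖ := by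
    filter_upwards [ae_restrict_mem measurableSet_Ioo] with x hx
    refine (hb x (Ioo_subset_Ioc_self hx)).trans (mul_le_mul_of_nonneg_left ?_ hMN)
    exact (hκb x hx).trans (le_abs_self _)
  have hum : AEStronglyMeasurable u (volIoo 0 1) :=
    (hflux.continuousOn.mono Ioo_subset_Ioi_self).aestronglyMeasurable measurableSet_Ioo
  refine ⟨u, w, hflux, h5, hκ.of_le_mul hum hbound, ?_⟩
  refine (eLpNorm_le_mul_eLpNorm_of_ae_le_mul hbound p).trans (le_of_eq ?_)
  rw [ENNReal.ofReal_mul hM0, hN, ENNReal.ofReal_toReal hf.2.ne, ENNReal.coe_mul,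
    ENNReal.coe_toNNReal hκ.2.ne]
  simp only [ENNReal.ofReal]
  ring

/-- `L^p` theory of `-(x^{2α} u')' + u = f` under the weighted Neumann condition at `0`. The
constant `C` depends on `α` and `p` only. -/
theorem theorem1p2 (α : ℝ) (hα : α < 1) (p : ℝ≥0∞) (hp : 1 ≤ p) :
    ∃ C : ℝ≥0, ∀ f : ℝ → ℝ, MemLp f p (volIoo 0 1) →
      ∃ u : ℝ → ℝ,
        -- existence
        IsNeumannSolution α p f u ∧
        -- uniqueness
        (∀ v : ℝ → ℝ, IsNeumannSolution α p f v → EqOn v u (Ioc 0 1)) ∧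
        -- bound in `L^p`
        (MemLp u p (volIoo 0 1) ∧
          eLpNorm u p (volIoo 0 1) ≤ C * eLpNorm f p (volIoo 0 1)) ∧
        -- behaviour of the derivative near `0`
        (p ≠ (⊤ : ℝ≥0∞) → Tendsto (fun x : ℝ => x ^ (2 * α - 1 + 1 / p.toReal) * deriv u x)
          (𝓝[>] 0) (𝓝 0)) ∧
        (p = (⊤ : ℝ≥0∞) → ∀ x ∈ Ioo (0 : ℝ) 1,
          ‖x ^ (2 * α - 1) * deriv u x‖ₑ ≤ C * eLpNorm f p (volIoo 0 1)) ∧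
        -- regularity of `x^{2α}` times the derivative
        (MemW1p 0 1 p (fun x => x ^ (2 * α) * deriv u x) ∧
          w1pNorm 0 1 p (fun x => x ^ (2 * α) * deriv u x) ≤
            C * eLpNorm f p (volIoo 0 1)) ∧
        -- the case `p > 1`, where `u''` is the weak derivative of `u'`
        (1 < p →
          WeaklyDifferentiable 0 1 (deriv u) ∧
          MemLp (fun x => x ^ (2 * α - 1) * deriv u x) p (volIoo 0 1) ∧
          MemLp (fun x => x ^ (2 * α) * weakDeriv 0 1 (deriv u) x) p (volIoo 0 1) ∧
          eLpNorm (fun x => x ^ (2 * α - 1) * deriv u x) p (volIoo 0 1) +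
              eLpNorm (fun x => x ^ (2 * α) * weakDeriv 0 1 (deriv u) x) p (volIoo 0 1) ≤
            C * eLpNorm f p (volIoo 0 1)) ∧
        -- Hölder regularity, where `w` is the continuous extension of `u` to `[0, 1]`
        (0 < α → α < 1 / 2 → ∃ w : ℝ → ℝ, EqOn w u (Ioc 0 1) ∧
          MemHolder (1 / 2 - α).toNNReal ((Icc (0 : ℝ) 1).domRestrict w) ∧
          holderNorm01 (1 / 2 - α).toNNReal w ≤ C * eLpNorm f p (volIoo 0 1)) ∧
        -- Sobolev regularity
        (α ≤ 0 → MemW1p 0 1 p u ∧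
          w1pNorm 0 1 p u ≤ C * eLpNorm f p (volIoo 0 1)) := by
  obtain ⟨C₀, hC₀⟩ := exists_isFlux_of_memLp hα hp
  -- One H is fixed for all p before f is given; for p = 1 its property is vacuous and 0 will do.
  obtain ⟨H, hH⟩ : ∃ H : ℝ≥0, 1 < p → ∀ g : ℝ → ℝ, MemLp g p (volIoo 0 1) →
      eLpNorm (fun x => x⁻¹ * ∫ t in (0 : ℝ)..x, g t) p (volIoo 0 1) ≤
        H * eLpNorm g p (volIoo 0 1) := by
    by_cases h1 : 1 < p
    · exact (exists_hardy_const h1).imp fun H hH _ => hH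
    · exact ⟨0, fun h => absurd h h1⟩
  set kW : ℝ≥0 := H + (‖2 * α‖₊ * H + 1) with hkW
  set kH : ℝ≥0 := 2 * (1 - 2 * α)⁻¹.toNNReal with hkH
  set K : ℝ≥0 := 2 + kW + kH with hK
  -- Each quantity is at most C₀ ‖f‖ + K ‖u - f‖, and ‖u - f‖ ≤ (C₀ + 1) ‖f‖.
  refine ⟨C₀ + K * (C₀ + 1), fun f hf => ?_⟩
  obtain ⟨u, w, hflux, hu1, hu, hule⟩ := hC₀ f hf
  have hg : MemLp (fun x => u x - f x) p (volIoo 0 1) := hu.sub hf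
  have hgle : eLpNorm (fun x => u x - f x) p (volIoo 0 1) ≤
      (C₀ + 1 : ℝ≥0) * eLpNorm f p (volIoo 0 1) := by
    refine (eLpNorm_sub_le hu.1 hf.1 hp).trans ?_
    push_cast
    rw [add_mul, one_mul]
    gcongr
  have main : ∀ {k : ℝ≥0} {X : ℝ≥0∞}, k ≤ K →
      X ≤ C₀ * eLpNorm f p (volIoo 0 1) + k * eLpNorm (fun x => u x - f x) p (volIoo 0 1) →
      X ≤ (C₀ + K * (C₀ + 1) : ℝ≥0) * eLpNorm f p (volIoo 0 1) := by
    intro k X hk hX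
    calc X ≤ C₀ * eLpNorm f p (volIoo 0 1) +
          K * ((C₀ + 1 : ℝ≥0) * eLpNorm f p (volIoo 0 1)) :=
          hX.trans (by gcongr)
      _ = _ := by push_cast; ring
  have hk1 : (1 : ℝ≥0) ≤ K := by
    rw [hK, add_assoc]
    exact one_le_two.trans le_self_add
  have hk2 : (2 : ℝ≥0) ≤ K := by
    rw [hK, add_assoc]
    exact le_self_add
  have hkW' : kW ≤ K := le_add_self.trans le_self_add
  have hkH' : kH ≤ K := le_add_self
  have hsol := hflux.isNeumannSolution hg hu1
  refine ⟨u, hsol, fun v hv => hv.eqOn hsol, ⟨hu, ?_⟩, fun hpt => ?_, ?_, ⟨?_, ?_⟩, fun h1 => ?_,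
    fun hα0 hα2 => ?_, fun hα0 => ?_⟩
  · exact main (zero_le : (0 : ℝ≥0) ≤ K) (hule.trans le_self_add)
  · exact hflux.tendsto_rpow_mul_deriv hp hpt hg
  · rintro rfl x hx
    refine main hk1 ((hflux.enorm_rpow_mul_deriv_le hg hx).trans ?_)
    rw [ENNReal.coe_one, one_mul]
    exact le_add_self
  · exact hflux.memW1p_flux hp hg
  · exact main hk2 ((hflux.w1pNorm_flux_le hp hg).trans le_add_self)
  · obtain ⟨m1, m2, m3⟩ := hflux.weighted_bounds hp hg (hH h1 _ hg)
    exact ⟨(hflux.isWeakDeriv_deriv le_rfl).weaklyDifferentiable, m1, m2,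
      main hkW' (m3.trans le_add_self)⟩
  · obtain ⟨U, hU, hU', hUn⟩ := hflux.exists_holder_extension hp hg hu1 hα0 hα2
    exact ⟨U, hU, hU', main hkH' (hUn.trans le_add_self)⟩
  · obtain ⟨m1, m2⟩ := hflux.memW1p_of_nonpos hp hg hu hα0
    refine ⟨m1, main hk1 (m2.trans ?_)⟩
    rw [ENNReal.coe_one, one_mul]
    gcongr
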